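/- **Problem.** Let $n\in\mathbb N$, let $l,u\in(\mathbb R\cup\{\pm\infty\})^n$ with $l_i<u_i$ for all $i$ and at least one finite entry, let $\mathcal B=\{x\in\mathbb R^n: l\le x\le u\}$, $\mathcal L=\{i:l_i>-\infty\}$, $\mathcal U=\{i:u_i<\infty\}$, and consider $\min f(x)$ subject to $x\in\mathcal B$. Assume that $f$ is continuously differentiable on an open set containing $\mathcal B$, that $f$ is bounded below and above on $\mathcal B$, and that on $\mathcal B$ the gradient $\nabla f$ is Lipschitz in the 2-norm with constant $\ell>0$ and bounded by $\kappa_2>0$ in the 2-norm and by $\kappa_\infty>0$ in the $\infty$-norm. For $\theta>0$ let $\mathcal N(\theta)=\{x: l+\theta\le x\le u-\theta\}$. Let $\bar\Delta>0$ and $\Delta=\min\{\bar\Delta,\min_i(u_i-l_i)\}$. Throughout, $1/\infty=0$. For $x,x'$ put $a(x,x')=\min_i (x_i-l_i)\min\{x_i-l_i,x'_i-l_i\}$ and $b(x,x')=\min_i (u_i-x_i)\min\{u_i-x_i,u_i-x'_i\}$. **Parameters.** Let $\sigma_2,\sigma_\infty\ge0$; let $t_\mu=t_\theta\in(-1,-\tfrac12)$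 and $t_\alpha<0$ satisfy $t_\mu+t_\alpha\in[-1,0)$ and $t_\mu+2t_\alpha<-1$; let $0<\theta_0<\Delta/2$, $\mu_1>\dfrac{\frac12\theta_0(\kappa_\infty+\sigma_\infty)\Delta}{\frac12\Delta-\theta_0}$ with $\mu_1>0$, and for all $k\ge1$ let $\mu_k=\mu_1k^{t_\mu}$, $\theta_{k-1}=\theta_0k^{t_\theta}$. Let $0<\underline r\le\lambda_{k,\min}\le\lambda_{k,\max}$ for all $k\ge1$, and let $0\le\alpha_{k,\mathrm{buff}}\le\alpha_{\mathrm{buff}}k^{2t_\mu}$ and $0\le\gamma_{k,\mathrm{buff}}\le\gamma_{\mathrm{buff}}k^{t_\mu}$ for constants $\alpha_{\mathrm{buff}},\gamma_{\mathrm{buff}}\ge0$. All these quantities are deterministic. Define $$\alpha_{k,\min}=\frac{\lambda_{k,\min}k^{t_\alpha}}{\ell+2\mu_k\theta_k^{-2}},\qquad \alpha_{k,\max}=\alpha_{k,\min}+\alpha_{k,\mathrm{buff}},$$ $$\gamma_{k,\min}=\min\left\{1,\frac{\lambda_{k,\min}\left(\frac{\frac12\mu_k\Delta}{\mu_k+\frac12(\kappa_\infty+\sigma_\infty)\Delta}-\theta_k\right)}{\alpha_{k,\max}(\kappa_\infty+\sigma_\infty+\mu_k\theta_{k-1}^{-1})}\right\},\qquad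 \gamma_{k,\max}=\min\{1,\gamma_{k,\min}+\gamma_{k,\mathrm{buff}}\}.$$ **Algorithm.** Let $X_1=x_1\in\mathcal N(\theta_0)$ be deterministic. For $k=1,2,\dots$, given $X_k$, a random gradient estimate $G_k$, and a random diagonal matrix $H_k$ with $\lambda_{k,\min}I\preceq H_k\preceq\lambda_{k,\max}I$, set $$Q_k=G_k-\mu_k\,\mathrm{diag}(X_k-l)^{-1}\mathbf 1+\mu_k\,\mathrm{diag}(u-X_k)^{-1}\mathbf 1,\qquad D_k=-H_k^{-1}Q_k,$$ $$A_{k,\mathrm{pre}}=\frac{\lambda_{k,\min}k^{t_\alpha}}{\ell+\mu_ka(X_k,X_k)^{-1}+\mu_kb(X_k,X_k)^{-1}},\qquad \overline\Gamma_k=\max\{\gamma\in(0,\gamma_{k,\max}]:X_k+\gamma A_{k,\mathrm{pre}}D_k\in\mathcal N(\theta_k)\},$$ $$L_k=\ell+\mu_ka(X_k,\overline X_k)^{-1}+\mu_kb(X_k,\overline X_k)^{-1}\ \text{ with }\ \overline X_k=X_k+\overline\Gamma_kA_{k,\mathrm{pre}}D_k,\qquad A_k=\min\left\{\frac{\lambda_{k,\min}k^{t_\alpha}}{L_k},\alpha_{k,\max}\right\},$$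 $$\Gamma_k=\max\{\gamma\in(0,\gamma_{k,\max}]:X_k+\gamma A_kD_k\in\mathcal N(\theta_k)\},\qquad X_{k+1}=X_k+\Gamma_kA_kD_k.$$ **Stochastic assumptions.** Let $\mathcal F_k$ be the $\sigma$-algebra generated by a $\sigma$-algebra of initial conditions and $G_1,\dots,G_{k-1}$. For all $k\ge1$ assume that $\mathbb E[G_k\mid\mathcal F_k]=\nabla f(X_k)$, that $\|G_k-\nabla f(X_k)\|_2\le\sigma_2$ and $\|G_k-\nabla f(X_k)\|_\infty\le\sigma_\infty$ almost surely, and that $H_k$ is $\mathcal F_k$-measurable. Assume moreover that there are $\chi>1$ and an open set $\mathcal X\subseteq\operatorname{int}\mathcal B$, both independent of the realization, such that almost surely, for all $k\ge1$, $X_k\in\mathcal X$, $X_{k,i}-l_i\le\chi$ for $i\in\mathcal L$, and $u_i-X_{k,i}\le\chi$ for $i\in\mathcal U$. Let $$\tilde\phi(x,\mu)=f(x)-\mu\sum_{i\in\mathcal L}\log\frac{x_i-l_i}{\chi}-\mu\sum_{i\in\mathcal U}\log\frac{u_i-x_i}{\chi}.$$ **Theorem.** Under these assumptions: 1. $\displaystyle\liminf_{k\to\infty}\|\nabla_x\tilde\phi(X_k,\mu_k)\|^2_{H_k^{-1}}=0$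 almost surely, where $\|v\|^2_{H^{-1}}=v^TH^{-1}v$. 2. If there is $\overline r>0$ with $\lambda_{k,\max}\le\overline r$ for all $k\ge1$, then $\displaystyle\liminf_{k\to\infty}\|\nabla_x\tilde\phi(X_k,\mu_k)\|^2_2=0$ almost surely. 3. If, in a given run with iterates $\{x_k\}$, there are an infinite set $\mathcal K\subseteq\mathbb N$ and $\bar x\in\mathcal B$ with $\{\nabla_x\tilde\phi(x_k,\mu_k)\}_{k\in\mathcal K}\to0$ and $\{x_k\}_{k\in\mathcal K}\to\bar x$, then $\bar x$ is a KKT point: there are $y,z\in\mathbb R^n$ with $\nabla f(\bar x)-y+z=0$, $0\le\bar x-l\perp y\ge0$ and $0\le u-\bar x\perp z\ge0$ (in particular $y_i=0$ for $i\notin\mathcal L$ and $z_i=0$ for $i\notin\mathcal U$). -/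

import Mathlib

open Filter Topology MeasureTheory
open scoped Matrix Gradient

noncomputable section

namespace BoundIPM

/-- Euclidean space of dimension `n`, with the 2-norm. -/
abbrev Vec (n : ℕ) := EuclideanSpace ℝ (Fin n)

/-- Data of the bound-constrained problem `min f(x)` subject to `l ≤ x ≤ u`.  The objective has the
set `dom` as its domain; the values of `f` outside `dom` are irrelevant. -/
structure BoundProblem (n : ℕ) where
  l : Fin n → EReal
  u : Fin n → EReal
  dom : Set (Vec n)
  f : Vec n → ℝ

namespace BoundProblem

variable {n : ℕ} (P : BoundProblem n)

/-- The feasible region `[l,u]`. -/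
def feasible : Set (Vec n) :=
  {x | ∀ i, P.l i ≤ (x i : EReal) ∧ (x i : EReal) ≤ P.u i}

/-- The inner neighborhood `{x : l + θ ≤ x ≤ u - θ}`. -/
def nbhd (θ : ℝ) : Set (Vec n) :=
  {x | ∀ i, P.l i + (θ : EReal) ≤ (x i : EReal) ∧ (x i : EReal) ≤ P.u i - (θ : EReal)}

open Classical in
/-- Indices with a finite lower bound. -/
def lowerIdx : Finset (Fin n) := Finset.univ.filter fun i => P.l i ≠ ⊥

open Classical in
/-- Indices with a finite upper bound. -/
def upperIdx : Finset (Fin n) := Finset.univ.filter fun i => P.u i ≠ ⊤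

/-- `x i - l i`; only used for indices with a finite lower bound. -/
def lowGap (x : Vec n) (i : Fin n) : ℝ := x i - (P.l i).toReal

/-- `u i - x i`; only used for indices with a finite upper bound. -/
def upGap (x : Vec n) (i : Fin n) : ℝ := (P.u i).toReal - x i

/-- Standing conditions on the bounds: `l i < u i` for every `i`, and some bound is finite. -/
structure BoundsOK : Prop where
  lt : ∀ i, P.l i < P.u i
  some_finite : ∃ i, P.l i ≠ ⊥ ∨ P.u i ≠ ⊤

/-- The objective is continuously differentiable on the open set `dom ⊇ [l,u]`, bounded on `[l,u]`,
and its gradient is Lipschitz on `[l,u]` with constant `ℓ` and bounded there by `κ₂` in the 2-norm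
and by `κinf` in the max-norm. -/
structure ObjectiveOK (ℓ κ₂ κinf : ℝ) : Prop where
  isOpen_dom : IsOpen P.dom
  feasible_subset : P.feasible ⊆ P.dom
  contDiffOn : ContDiffOn ℝ 1 P.f P.dom
  bddBelow : BddBelow (P.f '' P.feasible)
  bddAbove : BddAbove (P.f '' P.feasible)
  lip_pos : 0 < ℓ
  lipschitz : ∀ x ∈ P.feasible, ∀ y ∈ P.feasible, ‖∇ P.f x - ∇ P.f y‖ ≤ ℓ * ‖x - y‖
  kappa2_pos : 0 < κ₂
  kappa2 : ∀ x ∈ P.feasible, ‖∇ P.f x‖ ≤ κ₂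
  kappaInf_pos : 0 < κinf
  kappaInf : ∀ x ∈ P.feasible, ∀ i, |∇ P.f x i| ≤ κinf

/-- The scaled barrier-augmented function `φ̃(x, μ)` with scaling `χ`. -/
def barrier (χ : ℝ) (x : Vec n) (μ : ℝ) : ℝ :=
  P.f x - μ * ∑ i ∈ P.lowerIdx, Real.log (P.lowGap x i / χ)
    - μ * ∑ i ∈ P.upperIdx, Real.log (P.upGap x i / χ)

/-- The gradient of `φ̃` with respect to its first argument. -/
def barrierGrad (χ : ℝ) (x : Vec n) (μ : ℝ) : Vec n :=
  ∇ (fun y => P.barrier χ y μ) x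

open Classical in
/-- `g - μ diag(x - l)⁻¹ 1 + μ diag(u - x)⁻¹ 1`, where infinite distances contribute `1/∞ = 0`. -/
def barrierEstimate (g x : Vec n) (μ : ℝ) : Vec n :=
  WithLp.toLp 2 fun i =>
    g i - (if i ∈ P.lowerIdx then μ * (P.lowGap x i)⁻¹ else 0)
      + (if i ∈ P.upperIdx then μ * (P.upGap x i)⁻¹ else 0)

open Classical in
/-- `a(x, x')⁻¹` with `a(x, x') = min_i (x i - l i) * min (x i - l i) (x' i - l i)`.  Indices without
a finite lower bound contribute `∞` to the minimum; if there is no other index then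
`a(x, x')⁻¹ = 1/∞ = 0`. -/
def aInv (x x' : Vec n) : ℝ :=
  if h : P.lowerIdx.Nonempty then
    (P.lowerIdx.inf' h fun i => P.lowGap x i * min (P.lowGap x i) (P.lowGap x' i))⁻¹
  else 0

open Classical in
/-- `b(x, x')⁻¹` with `b(x, x') = min_i (u i - x i) * min (u i - x i) (u i - x' i)`, with the same
convention for indices without a finite upper bound. -/
def bInv (x x' : Vec n) : ℝ :=
  if h : P.upperIdx.Nonempty then
    (P.upperIdx.inf' h fun i => P.upGap x i * min (P.upGap x i) (P.upGap x' i))⁻¹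
  else 0

/-- `Δ = min {Δbar, min_i (u i - l i)}`. -/
def width (Δbar : ℝ) : ℝ := (min (Δbar : EReal) (⨅ i, P.u i - P.l i)).toReal

/-- `x` is a KKT point: `∇f(x) - y + z = 0`, `0 ≤ x - l ⟂ y ≥ 0`, `0 ≤ u - x ⟂ z ≥ 0` for some
multipliers `y`, `z`. -/
def IsKKT (x : Vec n) : Prop :=
  ∃ y z : Vec n, ∇ P.f x - y + z = 0 ∧
    (∀ i, 0 ≤ (x i : EReal) - P.l i ∧ 0 ≤ y i ∧ ((x i : EReal) - P.l i = 0 ∨ y i = 0)) ∧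
    (∀ i, 0 ≤ P.u i - (x i : EReal) ∧ 0 ≤ z i ∧ (P.u i - (x i : EReal) = 0 ∨ z i = 0))

end BoundProblem

/-- `‖v‖²` in the norm defined by `H⁻¹`, i.e. `vᵀ H⁻¹ v`. -/
def normSqInv {n : ℕ} (H : Matrix (Fin n) (Fin n) ℝ) (v : Vec n) : ℝ :=
  v.ofLp ⬝ᵥ (H⁻¹ *ᵥ v.ofLp)

/-- Prescribed (deterministic) quantities of the algorithm.  Sequences are indexed by `k = 1, 2, …`
(their value at `0` is irrelevant), except `θ`, which is indexed by `k = 0, 1, 2, …`. -/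
structure Params where
  /-- Lipschitz constant of the gradient on `[l,u]`. -/
  lip : ℝ
  /-- Bound for the gradient on `[l,u]` in the 2-norm. -/
  kappa2 : ℝ
  /-- Bound for the gradient on `[l,u]` in the max-norm. -/
  kappaInf : ℝ
  /-- Bound for the gradient error in the 2-norm. -/
  sigma2 : ℝ
  /-- Bound for the gradient error in the max-norm. -/
  sigmaInf : ℝ
  Δbar : ℝ
  μ : ℕ → ℝ
  θ : ℕ → ℝ
  tμ : ℝ
  tθ : ℝ
  tα : ℝ
  αbuff : ℝ
  γbuff : ℝ
  αbuffSeq : ℕ → ℝ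
  γbuffSeq : ℕ → ℝ
  lamMin : ℕ → ℝ
  lamMax : ℕ → ℝ

namespace Params

variable {n : ℕ} (p : Params) (P : BoundProblem n)

/-- `α_{k,min}`. -/
def αmin (k : ℕ) : ℝ :=
  p.lamMin k * (k : ℝ) ^ p.tα / (p.lip + 2 * p.μ k * (p.θ k ^ 2)⁻¹)

/-- `α_{k,max}`. -/
def αmax (k : ℕ) : ℝ := p.αmin k + p.αbuffSeq k

/-- `γ_{k,min}`. -/
def γmin (k : ℕ) : ℝ :=
  min 1
    (p.lamMin k *
        ((1 / 2) * p.μ k * P.width p.Δbar /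
            (p.μ k + (1 / 2) * (p.kappaInf + p.sigmaInf) * P.width p.Δbar) - p.θ k) /
      (p.αmax k * (p.kappaInf + p.sigmaInf + p.μ k * (p.θ (k - 1))⁻¹)))

/-- `γ_{k,max}`. -/
def γmax (k : ℕ) : ℝ := min 1 (p.γmin P k + p.γbuffSeq k)

/-- `α_{k,pre}` at the iterate `x`. -/
def αpre (k : ℕ) (x : Vec n) : ℝ :=
  p.lamMin k * (k : ℝ) ^ p.tα / (p.lip + p.μ k * P.aInv x x + p.μ k * P.bInv x x)

/-- The Lipschitz estimate `ℓ_k` at the iterate `x` with trial point `x'`. -/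
def lipK (k : ℕ) (x x' : Vec n) : ℝ :=
  p.lip + p.μ k * P.aInv x x' + p.μ k * P.bInv x x'

/-- Admissible prescribed quantities: the conditions on the exponents, on the barrier and
neighborhood sequences, on the buffers and on the eigenvalue bounds. -/
structure Admissible : Prop where
  sigma2_nonneg : 0 ≤ p.sigma2
  sigmaInf_nonneg : 0 ≤ p.sigmaInf
  Δbar_pos : 0 < p.Δbar
  tμ_eq_tθ : p.tμ = p.tθ
  tμ_gt : -1 < p.tμ
  tμ_lt : p.tμ < -(1 / 2)
  tα_neg : p.tα < 0
  tμ_add_tα_ge : -1 ≤ p.tμ + p.tα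
  tμ_add_tα_lt : p.tμ + p.tα < 0
  tμ_add_two_tα_lt : p.tμ + 2 * p.tα < -1
  θ_zero_pos : 0 < p.θ 0
  θ_zero_lt : p.θ 0 < P.width p.Δbar / 2
  θ_eq : ∀ k : ℕ, 1 ≤ k → p.θ (k - 1) = p.θ 0 * (k : ℝ) ^ p.tθ
  μ_one_pos : 0 < p.μ 1
  μ_one_gt : (1 / 2) * p.θ 0 * (p.kappaInf + p.sigmaInf) * P.width p.Δbar /
      ((1 / 2) * P.width p.Δbar - p.θ 0) < p.μ 1
  μ_eq : ∀ k : ℕ, 1 ≤ k → p.μ k = p.μ 1 * (k : ℝ) ^ p.tμ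
  αbuff_nonneg : 0 ≤ p.αbuff
  γbuff_nonneg : 0 ≤ p.γbuff
  αbuffSeq_nonneg : ∀ k : ℕ, 1 ≤ k → 0 ≤ p.αbuffSeq k
  γbuffSeq_nonneg : ∀ k : ℕ, 1 ≤ k → 0 ≤ p.γbuffSeq k
  αbuffSeq_le : ∀ k : ℕ, 1 ≤ k → p.αbuffSeq k ≤ p.αbuff * (k : ℝ) ^ (2 * p.tμ)
  γbuffSeq_le : ∀ k : ℕ, 1 ≤ k → p.γbuffSeq k ≤ p.γbuff * (k : ℝ) ^ p.tμ
  lamMin_ge : ∃ r : ℝ, 0 < r ∧ ∀ k : ℕ, 1 ≤ k → r ≤ p.lamMin k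
  lamMin_le_lamMax : ∀ k : ℕ, 1 ≤ k → p.lamMin k ≤ p.lamMax k

end Params

/-- One iteration (the `k`-th, `k ≥ 1`) of the algorithm: from the iterate `x`, the gradient estimate
`g` and the scaling matrix `H` it computes the barrier gradient estimate `q`, the direction `d`, the
auxiliary parameter `γbar`, the step size `α`, the parameter `γ` and the next iterate `xnext`. -/
structure IsStep {n : ℕ} (P : BoundProblem n) (p : Params) (k : ℕ) (x g q : Vec n)
    (H : Matrix (Fin n) (Fin n) ℝ) (d : Vec n) (γbar α γ : ℝ) (xnext : Vec n) : Prop where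
  H_diag : H.IsDiag
  H_ge : (H - p.lamMin k • (1 : Matrix (Fin n) (Fin n) ℝ)).PosSemidef
  H_le : (p.lamMax k • (1 : Matrix (Fin n) (Fin n) ℝ) - H).PosSemidef
  q_eq : q = P.barrierEstimate g x (p.μ k)
  d_eq : d = -WithLp.toLp 2 (H⁻¹ *ᵥ q.ofLp)
  γbar_max : IsGreatest
    {s : ℝ | 0 < s ∧ s ≤ p.γmax P k ∧ x + (s * p.αpre P k x) • d ∈ P.nbhd (p.θ k)} γbar
  α_eq : α = min
    (p.lamMin k * (k : ℝ) ^ p.tα / p.lipK P k x (x + (γbar * p.αpre P k x) • d)) (p.αmax k)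
  γ_max : IsGreatest
    {s : ℝ | 0 < s ∧ s ≤ p.γmax P k ∧ x + (s * α) • d ∈ P.nbhd (p.θ k)} γ
  xnext_eq : xnext = x + (γ * α) • d

/-- The random variables of the algorithm, indexed by the iteration `k = 1, 2, …` (the values at
`k = 0` are irrelevant). -/
structure RandomRun (n : ℕ) (Ω : Type*) where
  X : ℕ → Ω → Vec n
  G : ℕ → Ω → Vec n
  Q : ℕ → Ω → Vec n
  H : ℕ → Ω → Matrix (Fin n) (Fin n) ℝ
  D : ℕ → Ω → Vec n
  Γbar : ℕ → Ω → ℝ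
  A : ℕ → Ω → ℝ
  Γ : ℕ → Ω → ℝ

namespace RandomRun

variable {n : ℕ} {Ω : Type*} (Z : RandomRun n Ω)

/-- Every realization is a run of the algorithm started at `x₁ ∈ N(θ₀)`. -/
structure IsRun (P : BoundProblem n) (p : Params) (x₁ : Vec n) : Prop where
  start_mem : x₁ ∈ P.nbhd (p.θ 0)
  start : ∀ ω, Z.X 1 ω = x₁
  step : ∀ k : ℕ, 1 ≤ k → ∀ ω, IsStep P p k (Z.X k ω) (Z.G k ω) (Z.Q k ω) (Z.H k ω) (Z.D k ω)
    (Z.Γbar k ω) (Z.A k ω) (Z.Γ k ω) (Z.X (k + 1) ω)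

/-- The σ-algebra generated by the σ-algebra `m₀` of the initial conditions and by the gradient
estimators `G 1, …, G (k - 1)`. -/
@[reducible]
def history (m₀ : MeasurableSpace Ω) (k : ℕ) : MeasurableSpace Ω :=
  m₀ ⊔ ⨆ j ∈ Finset.Ico 1 k, MeasurableSpace.comap (Z.G j) inferInstance

/-- Almost surely all iterates lie in one open subset of the interior of `[l,u]` and have distance at
most `χ` to every finite bound; the open set and `χ` do not depend on the realization. -/
def BoundedIterates [MeasurableSpace Ω] (ℙ : Measure Ω) (P : BoundProblem n) (χ : ℝ) : Prop :=
  1 < χ ∧ ∃ S : Set (Vec n), IsOpen S ∧ S ⊆ interior P.feasible ∧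
    ∀ᵐ ω ∂ℙ, ∀ k : ℕ, 1 ≤ k → Z.X k ω ∈ S ∧
      (∀ i ∈ P.lowerIdx, P.lowGap (Z.X k ω) i ≤ χ) ∧
      (∀ i ∈ P.upperIdx, P.upGap (Z.X k ω) i ≤ χ)

/-- The gradient estimators are random vectors that are conditionally unbiased and have almost surely
bounded errors, and `H k` is measurable with respect to the history up to iteration `k`. -/
structure EstimatorsOK (m₀ : MeasurableSpace Ω) [mΩ : MeasurableSpace Ω] (ℙ : Measure Ω)
    (P : BoundProblem n) (p : Params) : Prop where
  init_le : m₀ ≤ mΩ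
  measurable_G : ∀ k : ℕ, 1 ≤ k → Measurable[mΩ] (Z.G k)
  unbiased : ∀ k : ℕ, 1 ≤ k → ℙ[Z.G k | Z.history m₀ k] =ᵐ[ℙ] fun ω => ∇ P.f (Z.X k ω)
  error2 : ∀ k : ℕ, 1 ≤ k → ∀ᵐ ω ∂ℙ, ‖Z.G k ω - ∇ P.f (Z.X k ω)‖ ≤ p.sigma2
  errorInf : ∀ k : ℕ, 1 ≤ k → ∀ᵐ ω ∂ℙ, ∀ i, |Z.G k ω i - ∇ P.f (Z.X k ω) i| ≤ p.sigmaInf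
  measurable_H : ∀ k : ℕ, 1 ≤ k → ∀ i j, Measurable[Z.history m₀ k] fun ω => Z.H k ω i j

end RandomRun

end BoundIPM

end

/-!
The iterates stay in the shrinking neighborhoods `N(θ (k - 1))`, and the barrier parameters `μ k` and
the neighborhood parameters `θ (k - 1)` decay at the same rate; hence the barrier gradients
`v k = ∇φ̃(X k, μ k)` are uniformly bounded. The argument is a stochastic descent argument for `φ̃`.

On the segment from `X k` to the trial point, which contains `X (k + 1)` (`IsStep.γ_mul_α_le`), the
function `φ̃(·, μ k)` has a quadratic upper bound with the constant `L k` of the algorithm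
(`BoundsOK.barrier_le`), and the step size satisfies `A k * L k ≤ λ_{k,min} k ^ tα`. The step `Γ k * A k`
depends on the gradient estimate, but it lies between the deterministic numbers `γmin k * αmin k` and
`γmax k * αmax k`. The lower bound for `Γ k` (`IsStep.γmin_le_γ`) holds because close to a bound the
barrier term forces the search direction inwards. Replacing the step by `γmin k * αmin k` in the terms
linear in `v k` gives `IsStep.decrease`: up to errors that are summable by the conditions on the
exponents (`exists_summable_error`), `φ̃` decreases by `γmin k * αmin k / 2` times `‖v k‖²` in the norm
of `H k ⁻¹`, plus a term that is linear in the noise `G k - ∇f(X k)` with an `F k`-measurable bounded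
coefficient.

The scaling by `χ` makes all logarithms nonpositive, so `φ̃` is monotone in `μ` and bounded below, and
the decreases telescope. The linear noise terms have expectation zero; this needs that `X k` is
`F k`-measurable, which follows by induction, the maximal step fractions being measurable because the
neighborhoods are convex and closed (`measurable_of_isGreatest`). Hence the series of
`γmin k * αmin k * ‖v k‖²` has finite expectation and converges almost surely
(`RandomRun.ae_summable`). As `γmin k * αmin k ≥ c / k` (`le_γmin_mul_αmin`), the limit inferior of
`‖v k‖²` is zero.

For the last part (`BoundsOK.isKKT_of_tendsto`), the multipliers are the limits of `μ k / (x k - l)` and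
`μ k / (u - x k)`. At an active bound the term of the opposite bound tends to zero, so the limit exists
because the barrier gradient tends to zero.
-/

namespace BoundIPM

/-! ### Bounds, neighborhoods and the interval width -/

namespace BoundProblem

variable {n : ℕ} {P : BoundProblem n}

theorem mem_lowerIdx {i : Fin n} : i ∈ P.lowerIdx ↔ P.l i ≠ ⊥ := by
  simp [lowerIdx]

theorem mem_upperIdx {i : Fin n} : i ∈ P.upperIdx ↔ P.u i ≠ ⊤ := by
  simp [upperIdx]

theorem BoundsOK.coe_toReal_l (hP : P.BoundsOK) {i : Fin n} (hi : i ∈ P.lowerIdx) :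
    (((P.l i).toReal : ℝ) : EReal) = P.l i :=
  EReal.coe_toReal (hP.lt i).ne_top (mem_lowerIdx.1 hi)

theorem BoundsOK.coe_toReal_u (hP : P.BoundsOK) {i : Fin n} (hi : i ∈ P.upperIdx) :
    (((P.u i).toReal : ℝ) : EReal) = P.u i :=
  EReal.coe_toReal (mem_upperIdx.1 hi) (hP.lt i).ne_bot

theorem BoundsOK.mem_nbhd_iff (hP : P.BoundsOK) {θ : ℝ} {x : Vec n} :
    x ∈ P.nbhd θ ↔ (∀ i ∈ P.lowerIdx, θ ≤ P.lowGap x i) ∧ ∀ i ∈ P.upperIdx, θ ≤ P.upGap x i := by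
  have low : ∀ i, P.l i + (θ : EReal) ≤ (x i : EReal) ↔ (i ∈ P.lowerIdx → θ ≤ P.lowGap x i) := by
    intro i
    by_cases hi : i ∈ P.lowerIdx
    · rw [← hP.coe_toReal_l hi]
      simp only [hi, lowGap, forall_true_left]
      norm_cast
      constructor <;> intro h <;> linarith
    · have : P.l i = ⊥ := by simpa [mem_lowerIdx] using hi
      simp [this, hi]
  have up : ∀ i, (x i : EReal) ≤ P.u i - (θ : EReal) ↔ (i ∈ P.upperIdx → θ ≤ P.upGap x i) := by
    intro i
    by_cases hi : i ∈ P.upperIdx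
    · rw [← hP.coe_toReal_u hi]
      simp only [hi, upGap, forall_true_left]
      norm_cast
      constructor <;> intro h <;> linarith
    · have : P.u i = ⊤ := by simpa [mem_upperIdx] using hi
      simp [this, hi]
  simp only [nbhd, Set.mem_ofPred_eq, low, up, forall_and]

theorem feasible_eq_nbhd_zero : P.feasible = P.nbhd 0 := by
  ext x; simp [feasible, nbhd]

theorem BoundsOK.nbhd_anti (hP : P.BoundsOK) {θ θ' : ℝ} (h : θ ≤ θ') : P.nbhd θ' ⊆ P.nbhd θ := by
  intro x hx
  rw [hP.mem_nbhd_iff] at hx ⊢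
  exact ⟨fun i hi => h.trans (hx.1 i hi), fun i hi => h.trans (hx.2 i hi)⟩

theorem BoundsOK.nbhd_subset_feasible (hP : P.BoundsOK) {θ : ℝ} (h : 0 ≤ θ) :
    P.nbhd θ ⊆ P.feasible :=
  feasible_eq_nbhd_zero (P := P) ▸ hP.nbhd_anti h

theorem BoundsOK.convex_nbhd (hP : P.BoundsOK) (θ : ℝ) : Convex ℝ (P.nbhd θ) := by
  intro x hx y hy a b ha hb hab
  rw [hP.mem_nbhd_iff] at hx hy ⊢
  simp only [lowGap, upGap, PiLp.add_apply, PiLp.smul_apply, smul_eq_mul] at hx hy ⊢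
  obtain rfl : b = 1 - a := by linarith
  constructor
  · intro i hi
    nlinarith [mul_le_mul_of_nonneg_left (hx.1 i hi) ha, mul_le_mul_of_nonneg_left (hy.1 i hi) hb]
  · intro i hi
    nlinarith [mul_le_mul_of_nonneg_left (hx.2 i hi) ha, mul_le_mul_of_nonneg_left (hy.2 i hi) hb]

theorem BoundsOK.convex_feasible (hP : P.BoundsOK) : Convex ℝ P.feasible :=
  feasible_eq_nbhd_zero (P := P) ▸ hP.convex_nbhd 0

theorem continuous_lowGap (i : Fin n) : Continuous fun x => P.lowGap x i := by
  unfold lowGap; fun_prop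

theorem continuous_upGap (i : Fin n) : Continuous fun x => P.upGap x i := by
  unfold upGap; fun_prop

theorem BoundsOK.isClosed_nbhd (hP : P.BoundsOK) (θ : ℝ) : IsClosed (P.nbhd θ) := by
  have : P.nbhd θ = (⋂ i ∈ P.lowerIdx, {x | θ ≤ P.lowGap x i}) ∩
      ⋂ i ∈ P.upperIdx, {x | θ ≤ P.upGap x i} := by
    ext x; simp [hP.mem_nbhd_iff]
  rw [this]
  exact (isClosed_biInter fun i _ => isClosed_le continuous_const (continuous_lowGap i)).inter
    (isClosed_biInter fun i _ => isClosed_le continuous_const (continuous_upGap i))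

theorem BoundsOK.width_le (hP : P.BoundsOK) {Δbar : ℝ} (hw : 0 < P.width Δbar) {i : Fin n}
    (hl : i ∈ P.lowerIdx) (hu : i ∈ P.upperIdx) (x : Vec n) :
    P.width Δbar ≤ P.lowGap x i + P.upGap x i := by
  -- `toReal ⊥ = 0`, so a positive width is the value of a genuine real minimum
  have hbot : min (Δbar : EReal) (⨅ i, P.u i - P.l i) ≠ ⊥ := by
    intro h; simp [width, h] at hw
  have hle : min (Δbar : EReal) (⨅ i, P.u i - P.l i) ≤ P.u i - P.l i :=
    (min_le_right _ _).trans (iInf_le _ i)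
  rw [← hP.coe_toReal_l hl, ← hP.coe_toReal_u hu, ← EReal.coe_sub] at hle
  have := EReal.toReal_le_toReal hle hbot (EReal.coe_ne_top _)
  rw [EReal.toReal_coe] at this
  unfold width lowGap upGap
  linarith

/-! ### The constants `a⁻¹` and `b⁻¹` -/

open Classical in
/-- The common form of `aInv` and `bInv`: the reciprocal of `min_{i ∈ s} g i * min (g i) (g' i)`,
and `0` for empty `s`. -/
noncomputable def minInv (s : Finset (Fin n)) (g g' : Fin n → ℝ) : ℝ :=
  if h : s.Nonempty then (s.inf' h fun i => g i * min (g i) (g' i))⁻¹ else 0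

theorem aInv_eq_minInv (x x' : Vec n) :
    P.aInv x x' = minInv P.lowerIdx (P.lowGap x) (P.lowGap x') := rfl

theorem bInv_eq_minInv (x x' : Vec n) :
    P.bInv x x' = minInv P.upperIdx (P.upGap x) (P.upGap x') := rfl

section minInv

variable {s : Finset (Fin n)} {g g' : Fin n → ℝ}

theorem minInv_nonneg (hg : ∀ i ∈ s, 0 < g i) (hg' : ∀ i ∈ s, 0 < g' i) : 0 ≤ minInv s g g' := by
  unfold minInv
  split_ifs with h
  · exact inv_nonneg.2 (Finset.le_inf' _ _ fun i hi =>
      (mul_pos (hg i hi) (lt_min (hg i hi) (hg' i hi))).le)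
  · exact le_rfl

theorem inv_le_minInv (hg : ∀ i ∈ s, 0 < g i) (hg' : ∀ i ∈ s, 0 < g' i) {i : Fin n} (hi : i ∈ s) :
    (g i * min (g i) (g' i))⁻¹ ≤ minInv s g g' := by
  have h : s.Nonempty := ⟨i, hi⟩
  rw [minInv, dif_pos h]
  refine inv_anti₀ ?_ (Finset.inf'_le _ hi)
  exact (Finset.lt_inf'_iff _).2 fun j hj => mul_pos (hg j hj) (lt_min (hg j hj) (hg' j hj))

theorem minInv_le {c : ℝ} (hc : 0 ≤ c) (h : ∀ i ∈ s, (g i * min (g i) (g' i))⁻¹ ≤ c) :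
    minInv s g g' ≤ c := by
  unfold minInv
  split_ifs with hs
  · obtain ⟨i, hi, e⟩ := Finset.exists_mem_eq_inf' hs fun i => g i * min (g i) (g' i)
    rw [e]; exact h i hi
  · exact hc

theorem minInv_self_le (hg : ∀ i ∈ s, 0 < g i) (hg' : ∀ i ∈ s, 0 < g' i) :
    minInv s g g ≤ minInv s g g' := by
  refine minInv_le (minInv_nonneg hg hg') fun i hi => le_trans ?_ (inv_le_minInv hg hg' hi)
  refine inv_anti₀ (mul_pos (hg i hi) (lt_min (hg i hi) (hg' i hi))) ?_
  rw [min_self]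
  exact mul_le_mul_of_nonneg_left (min_le_left _ _) (hg i hi).le

theorem minInv_le_of_le {θ : ℝ} (hθ : 0 < θ) (hg : ∀ i ∈ s, θ ≤ g i) (hg' : ∀ i ∈ s, θ ≤ g' i) :
    minInv s g g' ≤ (θ ^ 2)⁻¹ := by
  refine minInv_le (by positivity) fun i hi => inv_anti₀ (by positivity) ?_
  rw [sq]
  exact mul_le_mul (hg i hi) (le_min (hg i hi) (hg' i hi)) hθ.le (hθ.le.trans (hg i hi))

end minInv

/-! ### The barrier gradient and the quadratic upper bound -/

theorem inner_barrierEstimate (g x h : Vec n) (μ : ℝ) :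
    inner ℝ (P.barrierEstimate g x μ) h = inner ℝ g h
      - μ * ∑ i ∈ P.lowerIdx, (P.lowGap x i)⁻¹ * h i
      + μ * ∑ i ∈ P.upperIdx, (P.upGap x i)⁻¹ * h i := by
  classical
  have e : ∀ (s : Finset (Fin n)) (w : Fin n → ℝ), μ * ∑ i ∈ s, w i * h i =
      ∑ i, (if i ∈ s then μ * w i else 0) * h i := by
    intro s w
    simp [ite_mul, Finset.mul_sum, mul_assoc]
  rw [e, e, PiLp.inner_apply, PiLp.inner_apply, ← Finset.sum_sub_distrib, ← Finset.sum_add_distrib]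
  refine Finset.sum_congr rfl fun i _ => ?_
  simp only [barrierEstimate, RCLike.inner_apply, conj_trivial]
  split_ifs <;> ring

theorem ObjectiveOK.differentiableAt {ℓ κ₂ κinf : ℝ} (hf : P.ObjectiveOK ℓ κ₂ κinf) {x : Vec n}
    (hx : x ∈ P.feasible) : DifferentiableAt ℝ P.f x :=
  (hf.contDiffOn.contDiffAt (hf.isOpen_dom.mem_nhds (hf.feasible_subset hx))).differentiableAt
    one_ne_zero

theorem ObjectiveOK.continuousAt_gradient {ℓ κ₂ κinf : ℝ} (hf : P.ObjectiveOK ℓ κ₂ κinf) {x : Vec n}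
    (hx : x ∈ P.feasible) : ContinuousAt (∇ P.f) x := by
  have h := (hf.contDiffOn.contDiffAt (hf.isOpen_dom.mem_nhds (hf.feasible_subset hx)))
  exact (InnerProductSpace.toDual ℝ (Vec n)).symm.continuous.continuousAt.comp
    (h.fderiv_right (m := 0) (by norm_num)).continuousAt

theorem BoundsOK.barrierGrad_eq (hP : P.BoundsOK) {ℓ κ₂ κinf : ℝ} (hf : P.ObjectiveOK ℓ κ₂ κinf)
    {χ θ μ : ℝ} (hχ : 0 < χ) (hθ : 0 < θ) {x : Vec n} (hx : x ∈ P.nbhd θ) :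
    P.barrierGrad χ x μ = P.barrierEstimate (∇ P.f x) x μ := by
  have hd := hf.differentiableAt (hP.nbhd_subset_feasible hθ.le hx)
  rw [hP.mem_nbhd_iff] at hx
  have key : HasGradientAt (fun y => P.barrier χ y μ) (P.barrierEstimate (∇ P.f x) x μ) x := by
    rw [hasGradientAt_iff_hasFDerivAt]
    have h1 := hd.hasGradientAt.hasFDerivAt
    have hlow : HasFDerivAt (fun y : Vec n => ∑ i ∈ P.lowerIdx, Real.log (P.lowGap y i / χ))
        (∑ i ∈ P.lowerIdx, (P.lowGap x i)⁻¹ • (EuclideanSpace.proj i : Vec n →L[ℝ] ℝ)) x := by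
      refine HasFDerivAt.fun_sum fun i hi => ?_
      have h0 : 0 < P.lowGap x i := hθ.trans_le (hx.1 i hi)
      have h2 : HasFDerivAt (fun y : Vec n => P.lowGap y i / χ)
          (χ⁻¹ • (EuclideanSpace.proj i : Vec n →L[ℝ] ℝ)) x := by
        have h3 : HasFDerivAt (fun y : Vec n => y i) (EuclideanSpace.proj i : Vec n →L[ℝ] ℝ) x :=
          (EuclideanSpace.proj i : Vec n →L[ℝ] ℝ).hasFDerivAt
        have h4 := (h3.sub_const (P.l i).toReal).mul_const χ⁻¹
        simpa [lowGap, div_eq_mul_inv] using h4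
      have h5 := h2.log (by positivity)
      refine h5.congr_fderiv ?_
      rw [smul_smul]; congr 1; field_simp
    have hup : HasFDerivAt (fun y : Vec n => ∑ i ∈ P.upperIdx, Real.log (P.upGap y i / χ))
        (∑ i ∈ P.upperIdx, -(P.upGap x i)⁻¹ • (EuclideanSpace.proj i : Vec n →L[ℝ] ℝ)) x := by
      refine HasFDerivAt.fun_sum fun i hi => ?_
      have h0 : 0 < P.upGap x i := hθ.trans_le (hx.2 i hi)
      have h2 : HasFDerivAt (fun y : Vec n => P.upGap y i / χ)
          (-χ⁻¹ • (EuclideanSpace.proj i : Vec n →L[ℝ] ℝ)) x := by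
        have h3 : HasFDerivAt (fun y : Vec n => y i) (EuclideanSpace.proj i : Vec n →L[ℝ] ℝ) x :=
          (EuclideanSpace.proj i : Vec n →L[ℝ] ℝ).hasFDerivAt
        have h4 := (h3.const_sub (P.u i).toReal).mul_const χ⁻¹
        simpa [upGap, div_eq_mul_inv] using h4
      have h5 := h2.log (by positivity)
      refine h5.congr_fderiv ?_
      rw [smul_smul]; congr 1; field_simp
    have h := (h1.sub (hlow.const_mul μ)).sub (hup.const_mul μ)
    refine h.congr_fderiv ?_
    ext h
    simp only [sub_apply, smul_apply,
      InnerProductSpace.toDual_apply_apply, inner_barrierEstimate, sum_apply,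
      PiLp.proj_apply, smul_eq_mul, neg_mul, Finset.sum_neg_distrib]
    ring
  exact key.gradient

theorem ObjectiveOK.le_quadratic {ℓ κ₂ κinf : ℝ} (hf : P.ObjectiveOK ℓ κ₂ κinf) (hP : P.BoundsOK)
    {x y : Vec n} (hx : x ∈ P.feasible) (hy : y ∈ P.feasible) :
    P.f y ≤ P.f x + inner ℝ (∇ P.f x) (y - x) + ℓ / 2 * ‖y - x‖ ^ 2 := by
  set d := y - x with hd
  have hmem : ∀ t ∈ Set.Icc (0 : ℝ) 1, x + t • d ∈ P.feasible := fun t ht =>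
    hP.convex_feasible.add_smul_sub_mem hx hy ht
  have hder : ∀ t ∈ Set.Icc (0 : ℝ) 1, HasDerivAt
      (fun t : ℝ => P.f (x + t • d) - t * inner ℝ (∇ P.f x) d - ℓ / 2 * ‖d‖ ^ 2 * t ^ 2)
      (inner ℝ (∇ P.f (x + t • d)) d - inner ℝ (∇ P.f x) d - ℓ / 2 * ‖d‖ ^ 2 * (2 * t)) t := by
    intro t ht
    have h1 := (hf.differentiableAt (hmem t ht)).hasGradientAt.hasFDerivAt
    have h2 : HasDerivAt (fun t : ℝ => x + t • d) d t := by
      simpa using ((hasDerivAt_id t).smul_const d).const_add x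
    have h3 := h1.comp_hasDerivAt t h2
    have h4 := (h3.sub ((hasDerivAt_id t).mul_const (inner ℝ (∇ P.f x) d))).sub
      (((hasDerivAt_id t).pow 2).const_mul (ℓ / 2 * ‖d‖ ^ 2))
    refine h4.congr_deriv ?_
    simp
  have hanti : AntitoneOn
      (fun t : ℝ => P.f (x + t • d) - t * inner ℝ (∇ P.f x) d - ℓ / 2 * ‖d‖ ^ 2 * t ^ 2)
      (Set.Icc 0 1) := by
    refine antitoneOn_of_deriv_nonpos (convex_Icc 0 1)
      (fun t ht => (hder t ht).continuousAt.continuousWithinAt)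
      (fun t ht => (hder t (interior_subset ht)).differentiableAt.differentiableWithinAt) ?_
    intro t ht
    have ht := interior_subset ht
    rw [(hder t ht).deriv, ← inner_sub_left]
    have h1 := real_inner_le_norm (∇ P.f (x + t • d) - ∇ P.f x) d
    have h2 := hf.lipschitz _ (hmem t ht) _ hx
    rw [add_sub_cancel_left, norm_smul, Real.norm_of_nonneg ht.1] at h2
    have h3 := mul_le_mul_of_nonneg_right h2 (norm_nonneg d)
    nlinarith
  have := hanti (Set.left_mem_Icc.2 zero_le_one) (Set.right_mem_Icc.2 zero_le_one) zero_le_one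
  simp only [one_smul, zero_smul, add_zero, one_mul, zero_mul, one_pow, mul_one, sub_zero,
    ne_eq, OfNat.ofNat_ne_zero, not_false_eq_true, zero_pow, mul_zero] at this
  rw [show x + d = y by simp [hd]] at this
  linarith

/-- One-dimensional quadratic upper bound for `-log`.  For `h < 0` it is the inequality
`y ≤ sinh y` at `y = log (s / (s + h))`. -/
theorem neg_log_le {s h χ c : ℝ} (hs : 0 < s) (hsh : 0 < s + h) (hχ : 0 < χ)
    (hc : (s * min s (s + h))⁻¹ ≤ c) :
    -Real.log ((s + h) / χ) ≤ -Real.log (s / χ) - s⁻¹ * h + c / 2 * h ^ 2 := by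
  suffices hmain : -Real.log (s + h) ≤ -Real.log s - s⁻¹ * h + (s * min s (s + h))⁻¹ / 2 * h ^ 2 by
    rw [Real.log_div hsh.ne' hχ.ne', Real.log_div hs.ne' hχ.ne']
    nlinarith [mul_le_mul_of_nonneg_right hc (sq_nonneg h)]
  rcases le_total 0 h with hh | hh
  · rw [min_eq_left (by linarith)]
    have h1 := Real.le_log_one_add_of_nonneg (div_nonneg hh hs.le)
    have h2 : Real.log (s + h) = Real.log s + Real.log (1 + h / s) := by
      rw [← Real.log_mul hs.ne' (by positivity)]; congr 1; field_simp
    have h3 : h / s - (h / s) ^ 2 / 2 ≤ 2 * (h / s) / (h / s + 2) := by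
      have : 0 ≤ h / s := div_nonneg hh hs.le
      rw [le_div_iff₀ (by positivity)]
      nlinarith [mul_nonneg this (sq_nonneg (h / s))]
    have h4 : s⁻¹ * h = h / s := by field_simp
    have h5 : (s * s)⁻¹ / 2 * h ^ 2 = (h / s) ^ 2 / 2 := by field_simp
    rw [h2, h4, h5]; linarith
  · rw [min_eq_right (by linarith)]
    have h1 : Real.log (s / (s + h)) ≤ Real.sinh (Real.log (s / (s + h))) :=
      Real.self_le_sinh_iff.2 (Real.log_nonneg ((one_le_div hsh).2 (by linarith)))
    rw [Real.sinh_log (by positivity), Real.log_div hs.ne' hsh.ne'] at h1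
    have h2 : (s / (s + h) - (s / (s + h))⁻¹) / 2 =
        - (s⁻¹ * h) + (s * (s + h))⁻¹ / 2 * h ^ 2 := by
      field_simp; ring
    linarith

/-- Quadratic upper bound for the barrier function.  The constants `ca` and `cb` bound the curvature
of the logarithms on the segment from `x` to `y`. -/
theorem BoundsOK.barrier_le (hP : P.BoundsOK) {ℓ κ₂ κinf : ℝ} (hf : P.ObjectiveOK ℓ κ₂ κinf)
    {χ θ μ ca cb : ℝ} (hχ : 0 < χ) (hθ : 0 < θ) (hμ : 0 ≤ μ) {x y : Vec n} (hx : x ∈ P.nbhd θ)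
    (hy : y ∈ P.nbhd θ) (hca0 : 0 ≤ ca) (hcb0 : 0 ≤ cb)
    (hca : ∀ i ∈ P.lowerIdx, (P.lowGap x i * min (P.lowGap x i) (P.lowGap y i))⁻¹ ≤ ca)
    (hcb : ∀ i ∈ P.upperIdx, (P.upGap x i * min (P.upGap x i) (P.upGap y i))⁻¹ ≤ cb) :
    P.barrier χ y μ ≤ P.barrier χ x μ + inner ℝ (P.barrierEstimate (∇ P.f x) x μ) (y - x)
      + (ℓ + μ * ca + μ * cb) / 2 * ‖y - x‖ ^ 2 := by
  have hq := hf.le_quadratic hP (hP.nbhd_subset_feasible hθ.le hx) (hP.nbhd_subset_feasible hθ.le hy)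
  rw [hP.mem_nbhd_iff] at hx hy
  have part : ∀ s : Finset (Fin n), ∑ i ∈ s, (y - x) i ^ 2 ≤ ‖y - x‖ ^ 2 := by
    intro s
    rw [EuclideanSpace.real_norm_sq_eq]
    exact Finset.sum_le_univ_sum_of_nonneg fun i => sq_nonneg _
  have hlow : -∑ i ∈ P.lowerIdx, Real.log (P.lowGap y i / χ) ≤
      -∑ i ∈ P.lowerIdx, Real.log (P.lowGap x i / χ)
        - ∑ i ∈ P.lowerIdx, (P.lowGap x i)⁻¹ * (y - x) i + ca / 2 * ‖y - x‖ ^ 2 := by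
    have h1 : ∀ i ∈ P.lowerIdx, -Real.log (P.lowGap y i / χ) ≤ -Real.log (P.lowGap x i / χ)
        - (P.lowGap x i)⁻¹ * (y - x) i + ca / 2 * (y - x) i ^ 2 := by
      intro i hi
      have e : P.lowGap y i = P.lowGap x i + (y - x) i := by simp [lowGap]
      have hyi := hθ.trans_le (hy.1 i hi)
      have hci := hca i hi
      rw [e] at hyi hci ⊢
      exact neg_log_le (hθ.trans_le (hx.1 i hi)) hyi hχ hci
    have h2 := Finset.sum_le_sum h1
    simp only [Finset.sum_add_distrib, Finset.sum_sub_distrib, Finset.sum_neg_distrib,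
      ← Finset.mul_sum] at h2
    nlinarith [part P.lowerIdx]
  have hup : -∑ i ∈ P.upperIdx, Real.log (P.upGap y i / χ) ≤
      -∑ i ∈ P.upperIdx, Real.log (P.upGap x i / χ)
        + ∑ i ∈ P.upperIdx, (P.upGap x i)⁻¹ * (y - x) i + cb / 2 * ‖y - x‖ ^ 2 := by
    have h1 : ∀ i ∈ P.upperIdx, -Real.log (P.upGap y i / χ) ≤ -Real.log (P.upGap x i / χ)
        + (P.upGap x i)⁻¹ * (y - x) i + cb / 2 * (y - x) i ^ 2 := by
      intro i hi
      have e : P.upGap y i = P.upGap x i + -(y - x) i := by simp [upGap]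
      have hyi := hθ.trans_le (hy.2 i hi)
      have hci := hcb i hi
      rw [e] at hyi hci ⊢
      have := neg_log_le (hθ.trans_le (hx.2 i hi)) hyi hχ hci
      rw [neg_sq] at this
      linarith
    have h2 := Finset.sum_le_sum h1
    simp only [Finset.sum_add_distrib, Finset.sum_neg_distrib,
      ← Finset.mul_sum] at h2
    nlinarith [part P.upperIdx]
  rw [inner_barrierEstimate]
  unfold barrier
  nlinarith [mul_le_mul_of_nonneg_left hlow hμ, mul_le_mul_of_nonneg_left hup hμ]

end BoundProblem

/-! ### Asymptotics of the prescribed sequences -/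

theorem natCast_rpow_pos {k : ℕ} (hk : 1 ≤ k) (t : ℝ) : 0 < (k : ℝ) ^ t :=
  Real.rpow_pos_of_pos (by exact_mod_cast hk) t

theorem natCast_rpow_le_one {k : ℕ} (hk : 1 ≤ k) {t : ℝ} (ht : t < 0) : (k : ℝ) ^ t ≤ 1 :=
  Real.rpow_le_one_of_one_le_of_nonpos (by exact_mod_cast hk) ht.le

namespace Params.Admissible

variable {n : ℕ} {P : BoundProblem n} {p : Params}

theorem width_pos (hp : p.Admissible P) : 0 < P.width p.Δbar := by
  linarith [hp.θ_zero_pos, hp.θ_zero_lt]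

theorem tμ_neg (hp : p.Admissible P) : p.tμ < 0 := by linarith [hp.tμ_lt]

theorem θ_pred_eq (hp : p.Admissible P) {k : ℕ} (hk : 1 ≤ k) :
    p.θ (k - 1) = p.θ 0 * (k : ℝ) ^ p.tμ := by
  rw [hp.θ_eq k hk, hp.tμ_eq_tθ]

theorem θ_eq_succ (hp : p.Admissible P) (k : ℕ) :
    p.θ k = p.θ 0 * ((k : ℝ) + 1) ^ p.tμ := by
  have := hp.θ_pred_eq (k := k + 1) (by omega)
  simpa using this

theorem θ_pos (hp : p.Admissible P) (k : ℕ) : 0 < p.θ k := by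
  rw [hp.θ_eq_succ]
  have := hp.θ_zero_pos
  positivity

theorem μ_pos (hp : p.Admissible P) {k : ℕ} (hk : 1 ≤ k) : 0 < p.μ k := by
  rw [hp.μ_eq k hk]
  exact mul_pos hp.μ_one_pos (natCast_rpow_pos hk _)

theorem θ_le (hp : p.Admissible P) {k : ℕ} (hk : 1 ≤ k) : p.θ k ≤ p.θ 0 * (k : ℝ) ^ p.tμ := by
  rw [hp.θ_eq_succ]
  refine mul_le_mul_of_nonneg_left ?_ hp.θ_zero_pos.le
  exact Real.rpow_le_rpow_of_nonpos (by exact_mod_cast hk) (by linarith) hp.tμ_neg.le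

theorem le_θ (hp : p.Admissible P) {k : ℕ} (hk : 1 ≤ k) :
    p.θ 0 * 2 ^ p.tμ * (k : ℝ) ^ p.tμ ≤ p.θ k := by
  have hk' : (1 : ℝ) ≤ k := by exact_mod_cast hk
  rw [hp.θ_eq_succ k, mul_assoc, ← Real.mul_rpow (by norm_num) (by linarith)]
  refine mul_le_mul_of_nonneg_left ?_ hp.θ_zero_pos.le
  exact Real.rpow_le_rpow_of_nonpos (by linarith) (by linarith) hp.tμ_neg.le

theorem θ_le_pred (hp : p.Admissible P) {k : ℕ} (hk : 1 ≤ k) : p.θ k ≤ p.θ (k - 1) :=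
  (hp.θ_le hk).trans_eq (hp.θ_pred_eq hk).symm

theorem μ_succ_le (hp : p.Admissible P) {k : ℕ} (hk : 1 ≤ k) : p.μ (k + 1) ≤ p.μ k := by
  rw [hp.μ_eq _ hk, hp.μ_eq (k + 1) (by omega)]
  refine mul_le_mul_of_nonneg_left ?_ hp.μ_one_pos.le
  exact Real.rpow_le_rpow_of_nonpos (by exact_mod_cast hk) (by push_cast; linarith) hp.tμ_neg.le

theorem tendsto_μ (hp : p.Admissible P) : Tendsto p.μ atTop (𝓝 0) := by
  have h := ((tendsto_rpow_neg_atTop (y := -p.tμ) (by linarith [hp.tμ_neg])).comp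
    tendsto_natCast_atTop_atTop).const_mul (p.μ 1)
  rw [mul_zero] at h
  refine h.congr' ?_
  filter_upwards [eventually_ge_atTop 1] with k hk
  simp [hp.μ_eq k hk]

/-- Because `μ` and `θ` decay at the same rate, barrier terms stay bounded along the iterates. -/
theorem μ_mul_inv_θ_pred (hp : p.Admissible P) {k : ℕ} (hk : 1 ≤ k) :
    p.μ k * (p.θ (k - 1))⁻¹ = p.μ 1 / p.θ 0 := by
  rw [hp.θ_pred_eq hk, hp.μ_eq k hk]
  have := (natCast_rpow_pos hk p.tμ).ne'
  have := hp.θ_zero_pos.ne'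
  field_simp

theorem lamMin_pos (hp : p.Admissible P) {k : ℕ} (hk : 1 ≤ k) : 0 < p.lamMin k := by
  obtain ⟨r, hr, h⟩ := hp.lamMin_ge
  exact hr.trans_le (h k hk)

theorem αmin_denom_pos (hp : p.Admissible P) (hℓ : 0 < p.lip) {k : ℕ} (hk : 1 ≤ k) :
    0 < p.lip + 2 * p.μ k * (p.θ k ^ 2)⁻¹ := by
  have := hp.μ_pos hk
  have := hp.θ_pos k
  positivity

theorem αmin_pos (hp : p.Admissible P) (hℓ : 0 < p.lip) {k : ℕ} (hk : 1 ≤ k) : 0 < p.αmin k :=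
  div_pos (mul_pos (hp.lamMin_pos hk) (natCast_rpow_pos hk _)) (hp.αmin_denom_pos hℓ hk)

theorem αmin_le_αmax (hp : p.Admissible P) {k : ℕ} (hk : 1 ≤ k) : p.αmin k ≤ p.αmax k :=
  le_add_of_nonneg_right (hp.αbuffSeq_nonneg k hk)

theorem αmax_pos (hp : p.Admissible P) (hℓ : 0 < p.lip) {k : ℕ} (hk : 1 ≤ k) : 0 < p.αmax k :=
  (hp.αmin_pos hℓ hk).trans_le (hp.αmin_le_αmax hk)

theorem αmin_le (hp : p.Admissible P) (hℓ : 0 < p.lip) {k : ℕ} (hk : 1 ≤ k) :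
    p.αmin k ≤ p.lamMin k * (p.θ 0 ^ 2 / (2 * p.μ 1) * ((k : ℝ) ^ p.tα * (k : ℝ) ^ p.tμ)) := by
  have hμ := hp.μ_one_pos
  have hθ0 := hp.θ_zero_pos
  have hθ := hp.θ_pos k
  have hθle := hp.θ_le hk
  have hlam := hp.lamMin_pos hk
  unfold αmin
  have hden := hp.αmin_denom_pos hℓ hk
  rw [div_le_iff₀ hden, hp.μ_eq k hk]
  generalize hy : (k : ℝ) ^ p.tμ = y at *
  have hy0 : 0 < y := hy ▸ natCast_rpow_pos hk _
  have hz0 := natCast_rpow_pos hk p.tα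
  generalize (k : ℝ) ^ p.tα = z at *
  have h1 : 1 ≤ p.θ 0 ^ 2 * y ^ 2 * (p.θ k ^ 2)⁻¹ := by
    rw [← div_eq_mul_inv, one_le_div (by positivity), ← mul_pow]
    exact pow_le_pow_left₀ hθ.le hθle 2
  calc p.lamMin k * z ≤ p.lamMin k * z * (p.θ 0 ^ 2 * y ^ 2 * (p.θ k ^ 2)⁻¹) :=
        le_mul_of_one_le_right (by positivity) h1
    _ = p.lamMin k * (p.θ 0 ^ 2 / (2 * p.μ 1) * (z * y)) * (2 * (p.μ 1 * y) * (p.θ k ^ 2)⁻¹) := by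
        field_simp
    _ ≤ _ := by
        refine mul_le_mul_of_nonneg_left ?_ (by positivity)
        linarith

theorem le_αmin (hp : p.Admissible P) (hℓ : 0 < p.lip) :
    ∃ c : ℝ, 0 < c ∧ ∀ k : ℕ, 1 ≤ k → c * (k : ℝ)⁻¹ ≤ p.αmin k := by
  obtain ⟨r, hr, hlam⟩ := hp.lamMin_ge
  have hμ := hp.μ_one_pos
  have hθ0 := hp.θ_zero_pos
  set η := p.θ 0 * 2 ^ p.tμ with hη
  have hη0 : 0 < η := by positivity
  refine ⟨r / (p.lip + 2 * p.μ 1 * (η ^ 2)⁻¹), by positivity, fun k hk => ?_⟩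
  have hθ := hp.θ_pos k
  have hθle := hp.le_θ hk
  rw [← hη] at hθle
  have hyz : (k : ℝ)⁻¹ ≤ (k : ℝ) ^ p.tα * (k : ℝ) ^ p.tμ := by
    have hk' : (1 : ℝ) ≤ k := by exact_mod_cast hk
    rw [← Real.rpow_add (by linarith), ← Real.rpow_neg_one]
    exact Real.rpow_le_rpow_of_exponent_le hk' (by linarith [hp.tμ_add_tα_ge])
  have hden := hp.αmin_denom_pos hℓ hk
  unfold αmin
  rw [hp.μ_eq k hk] at hden ⊢
  have hy0 := natCast_rpow_pos hk p.tμ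
  have hy1 := natCast_rpow_le_one hk hp.tμ_neg
  have hz0 := natCast_rpow_pos hk p.tα
  have hlamk := hlam k hk
  generalize (k : ℝ) ^ p.tμ = y at *
  generalize (k : ℝ) ^ p.tα = z at *
  have h1 : y * (p.lip + 2 * (p.μ 1 * y) * (p.θ k ^ 2)⁻¹) ≤ p.lip + 2 * p.μ 1 * (η ^ 2)⁻¹ := by
    have h2 : y ^ 2 * (p.θ k ^ 2)⁻¹ ≤ (η ^ 2)⁻¹ := by
      rw [← div_eq_mul_inv, div_le_iff₀ (by positivity), ← div_eq_inv_mul,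
        le_div_iff₀ (by positivity), ← mul_pow, mul_comm y]
      exact pow_le_pow_left₀ (by positivity) hθle 2
    have h3 := mul_le_mul_of_nonneg_left h2 (by positivity : 0 ≤ 2 * p.μ 1)
    nlinarith [mul_le_of_le_one_left hℓ.le hy1]
  rw [div_mul_eq_mul_div, div_le_div_iff₀ (by positivity) hden]
  have hr' : r * (k : ℝ)⁻¹ ≤ p.lamMin k * (z * y) :=
    mul_le_mul hlamk hyz (by positivity) (hr.le.trans hlamk)
  calc r * (k : ℝ)⁻¹ * (p.lip + 2 * (p.μ 1 * y) * (p.θ k ^ 2)⁻¹)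
      ≤ p.lamMin k * (z * y) * (p.lip + 2 * (p.μ 1 * y) * (p.θ k ^ 2)⁻¹) :=
        mul_le_mul_of_nonneg_right hr' hden.le
    _ = p.lamMin k * z * (y * (p.lip + 2 * (p.μ 1 * y) * (p.θ k ^ 2)⁻¹)) := by ring
    _ ≤ _ := mul_le_mul_of_nonneg_left h1 (by have := hp.lamMin_pos hk; positivity)

/-- The lower bound on `μ 1` keeps the trigger distance of the barrier (below which every search
direction points inwards) above `θ k`, uniformly after scaling. -/
theorem trigger_gap (hp : p.Admissible P) (hκ : 0 < p.kappaInf) :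
    ∃ δ : ℝ, 0 < δ ∧ ∀ k : ℕ, 1 ≤ k → δ * (k : ℝ) ^ p.tμ ≤
      (1 / 2) * p.μ k * P.width p.Δbar /
        (p.μ k + (1 / 2) * (p.kappaInf + p.sigmaInf) * P.width p.Δbar) - p.θ k := by
  have hM : 0 < p.kappaInf + p.sigmaInf := by linarith [hp.sigmaInf_nonneg]
  have hw := hp.width_pos
  have hμ1 := hp.μ_one_gt
  have hμ := hp.μ_one_pos
  have hlt := hp.θ_zero_lt
  rw [div_lt_iff₀ (by linarith)] at hμ1
  have hθle := fun k hk => hp.θ_le (k := k) hk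
  have hμeq := hp.μ_eq
  generalize P.width p.Δbar = Δ at *
  generalize p.kappaInf + p.sigmaInf = M at *
  refine ⟨(1 / 2) * p.μ 1 * Δ / (p.μ 1 + (1 / 2) * M * Δ) - p.θ 0, ?_, fun k hk => ?_⟩
  · rw [sub_pos, lt_div_iff₀ (by positivity)]
    nlinarith
  · have hy0 := natCast_rpow_pos hk p.tμ
    have hy1 := natCast_rpow_le_one hk hp.tμ_neg
    have h1 := hθle k hk
    rw [hμeq k hk]
    generalize (k : ℝ) ^ p.tμ = y at *
    have h2 : (1 / 2) * p.μ 1 * Δ / (p.μ 1 + (1 / 2) * M * Δ) * y ≤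
        (1 / 2) * (p.μ 1 * y) * Δ / (p.μ 1 * y + (1 / 2) * M * Δ) := by
      rw [div_mul_eq_mul_div, show (1 / 2) * p.μ 1 * Δ * y = (1 / 2) * (p.μ 1 * y) * Δ by ring]
      refine div_le_div_of_nonneg_left (by positivity) (by positivity) ?_
      nlinarith
    linarith

theorem αmax_le (hp : p.Admissible P) (hℓ : 0 < p.lip) :
    ∃ C : ℝ, 0 < C ∧ ∀ k : ℕ, 1 ≤ k →
      p.αmin k ≤ p.lamMin k * (C * ((k : ℝ) ^ p.tα * (k : ℝ) ^ p.tμ)) ∧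
      p.αbuffSeq k ≤ p.lamMin k * (C * (k : ℝ) ^ (2 * p.tμ)) := by
  obtain ⟨r, hr, hlam⟩ := hp.lamMin_ge
  have hμ := hp.μ_one_pos
  have hθ0 := hp.θ_zero_pos
  have hb := hp.αbuff_nonneg
  refine ⟨p.θ 0 ^ 2 / (2 * p.μ 1) + p.αbuff / r, by positivity, fun k hk => ⟨?_, ?_⟩⟩
  · refine (hp.αmin_le hℓ hk).trans (mul_le_mul_of_nonneg_left ?_ (hp.lamMin_pos hk).le)
    refine mul_le_mul_of_nonneg_right (by linarith [div_nonneg hb hr.le]) ?_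
    exact (mul_pos (natCast_rpow_pos hk _) (natCast_rpow_pos hk _)).le
  · refine (hp.αbuffSeq_le k hk).trans ?_
    rw [← mul_assoc]
    refine mul_le_mul_of_nonneg_right ?_ (natCast_rpow_pos hk _).le
    calc p.αbuff = r * (p.αbuff / r) := by field_simp
      _ ≤ p.lamMin k * (p.θ 0 ^ 2 / (2 * p.μ 1) + p.αbuff / r) :=
        mul_le_mul (hlam k hk) (by linarith [show 0 ≤ p.θ 0 ^ 2 / (2 * p.μ 1) by positivity])
          (by positivity) (hp.lamMin_pos hk).le

/-- The step fractions `γmin` are bounded away from zero. -/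
theorem le_γmin (hp : p.Admissible P) (hℓ : 0 < p.lip) (hκ : 0 < p.kappaInf) :
    ∃ c : ℝ, 0 < c ∧ ∀ k : ℕ, 1 ≤ k → c ≤ p.γmin P k := by
  obtain ⟨δ, hδ, hgap⟩ := hp.trigger_gap hκ
  obtain ⟨C, hC, hα⟩ := hp.αmax_le hℓ
  have hM : 0 < p.kappaInf + p.sigmaInf := by linarith [hp.sigmaInf_nonneg]
  have hμ := hp.μ_one_pos
  have hθ0 := hp.θ_zero_pos
  refine ⟨min 1 (δ / (2 * C * (p.kappaInf + p.sigmaInf + p.μ 1 / p.θ 0))),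
    lt_min one_pos (by positivity), fun k hk => min_le_min_left _ ?_⟩
  rw [hp.μ_mul_inv_θ_pred hk]
  have hE : 0 < p.kappaInf + p.sigmaInf + p.μ 1 / p.θ 0 := by positivity
  generalize p.kappaInf + p.sigmaInf + p.μ 1 / p.θ 0 = E at *
  have hαmax := hp.αmax_pos hℓ hk
  have hlam := hp.lamMin_pos hk
  have hk' : (0 : ℝ) < k := by exact_mod_cast hk
  rw [div_le_div_iff₀ (by positivity) (by positivity)]
  have hg := hgap k hk
  have hα' : p.αmax k ≤ p.lamMin k * (2 * C * (k : ℝ) ^ p.tμ) := by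
    have h1 := hα k hk
    unfold αmax
    rw [two_mul, Real.rpow_add hk'] at h1
    have hy0 := natCast_rpow_pos hk p.tμ
    have hy1 := natCast_rpow_le_one hk hp.tμ_neg
    have hz1 := natCast_rpow_le_one hk hp.tα_neg
    generalize (k : ℝ) ^ p.tμ = y at *
    generalize (k : ℝ) ^ p.tα = z at *
    have h2 : p.lamMin k * (C * (z * y)) ≤ p.lamMin k * (C * y) := by gcongr; nlinarith
    have h3 : p.lamMin k * (C * (y * y)) ≤ p.lamMin k * (C * y) := by gcongr; nlinarith
    linarith [h1.1, h1.2]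
  calc δ * (p.αmax k * E) ≤ δ * (p.lamMin k * (2 * C * (k : ℝ) ^ p.tμ) * E) := by gcongr
    _ = p.lamMin k * (δ * (k : ℝ) ^ p.tμ) * (2 * C * E) := by ring
    _ ≤ _ := by gcongr

theorem γmin_pos (hp : p.Admissible P) (hℓ : 0 < p.lip) (hκ : 0 < p.kappaInf) {k : ℕ}
    (hk : 1 ≤ k) : 0 < p.γmin P k := by
  obtain ⟨c, hc, h⟩ := hp.le_γmin hℓ hκ
  exact hc.trans_le (h k hk)

theorem γmin_le_γmax (hp : p.Admissible P) {k : ℕ} (hk : 1 ≤ k) : p.γmin P k ≤ p.γmax P k :=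
  le_min (min_le_left _ _) (le_add_of_nonneg_right (hp.γbuffSeq_nonneg k hk))

/-- Divergence of the guaranteed step lengths, at the harmonic rate. -/
theorem le_γmin_mul_αmin (hp : p.Admissible P) (hℓ : 0 < p.lip) (hκ : 0 < p.kappaInf) :
    ∃ c : ℝ, 0 < c ∧ ∀ k : ℕ, 1 ≤ k → c * (k : ℝ)⁻¹ ≤ p.γmin P k * p.αmin k := by
  obtain ⟨c, hc, h⟩ := hp.le_γmin hℓ hκ
  obtain ⟨c', hc', h'⟩ := hp.le_αmin hℓ
  refine ⟨c * c', by positivity, fun k hk => ?_⟩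
  rw [mul_assoc]
  exact mul_le_mul (h k hk) (h' k hk) (by positivity) (hc.le.trans (h k hk))

/-- Summability of the perturbations caused by the step size range and by the gradient noise.
The exponents that occur are `tμ + (tμ + tα)`, `2 tμ` and `tμ + 2 tα`, all less than `-1`. -/
theorem exists_summable_error (hp : p.Admissible P) (hℓ : 0 < p.lip) (hκ : 0 < p.kappaInf) {a b : ℝ}
    (ha : 0 ≤ a) (hb : 0 ≤ b) :
    ∃ ε : ℕ → ℝ, Summable ε ∧ (∀ k, 0 ≤ ε k) ∧ ∀ k : ℕ, 1 ≤ k →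
      (p.γmax P k * p.αmax k - p.γmin P k * p.αmin k) * (a / p.lamMin k)
        + (k : ℝ) ^ p.tα * (p.γmax P k * p.αmax k) * (b / p.lamMin k) ≤ ε k := by
  obtain ⟨C, hC, hα⟩ := hp.αmax_le hℓ
  have hgb := hp.γbuff_nonneg
  refine ⟨fun k => a * (p.γbuff * C * (k : ℝ) ^ (p.tμ + (p.tα + p.tμ)) + C * (k : ℝ) ^ (2 * p.tμ))
    + b * (C * (k : ℝ) ^ (p.tμ + 2 * p.tα) + C * (k : ℝ) ^ (2 * p.tμ)), ?_, ?_, ?_⟩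
  · have h1 := Real.summable_nat_rpow.2 (show p.tμ + (p.tα + p.tμ) < -1 by
      linarith [hp.tμ_lt, hp.tα_neg])
    have h2 := Real.summable_nat_rpow.2 (show 2 * p.tμ < -1 by linarith [hp.tμ_lt])
    have h3 := Real.summable_nat_rpow.2 hp.tμ_add_two_tα_lt
    exact (((h1.mul_left _).add (h2.mul_left _)).mul_left _).add
      (((h3.mul_left _).add (h2.mul_left _)).mul_left _)
  · intro k; positivity
  · intro k hk
    have hk' : (0 : ℝ) < k := by exact_mod_cast hk
    obtain ⟨h1, h2⟩ := hα k hk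
    have hlam := hp.lamMin_pos hk
    have hγ0 := hp.γmin_pos hℓ hκ hk
    have hγ1 : p.γmax P k ≤ 1 := min_le_left _ _
    have hγ2 : p.γmax P k ≤ p.γmin P k + p.γbuff * (k : ℝ) ^ p.tμ :=
      (min_le_right _ _).trans (by linarith [hp.γbuffSeq_le k hk])
    have hαm := hp.αmin_pos hℓ hk
    have hαb := hp.αbuffSeq_nonneg k hk
    have hγ3 := hγ0.le.trans (hp.γmin_le_γmax hk)
    have hz0 := natCast_rpow_pos hk p.tα
    have hz1 := natCast_rpow_le_one hk hp.tα_neg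
    have hy0 := natCast_rpow_pos hk p.tμ
    dsimp only
    rw [two_mul p.tα, Real.rpow_add hk', Real.rpow_add hk', Real.rpow_add hk', Real.rpow_add hk']
    have hx0 := natCast_rpow_pos hk (2 * p.tμ)
    unfold αmax
    generalize (k : ℝ) ^ (2 * p.tμ) = x at *
    generalize (k : ℝ) ^ p.tμ = y at *
    generalize (k : ℝ) ^ p.tα = z at *
    generalize p.lamMin k = lam at *
    have e1 : p.γmax P k * (p.αmin k + p.αbuffSeq k) - p.γmin P k * p.αmin k ≤
        lam * (p.γbuff * C * (y * (z * y)) + C * x) := by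
      have i1 := mul_le_mul_of_nonneg_right hγ2 hαm.le
      have i2 := mul_le_of_le_one_left hαb hγ1
      have i3 := mul_le_mul_of_nonneg_left h1 (by positivity : 0 ≤ p.γbuff * y)
      nlinarith
    have e2 : z * (p.γmax P k * (p.αmin k + p.αbuffSeq k)) ≤
        lam * (C * (y * (z * z)) + C * x) := by
      have i1 := mul_le_of_le_one_left (by positivity : 0 ≤ z * (p.αmin k + p.αbuffSeq k)) hγ1
      have i2 := mul_le_mul_of_nonneg_left h1 hz0.le
      have i3 := mul_le_of_le_one_left hαb hz1
      nlinarith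
    have f1 := mul_le_mul_of_nonneg_right e1 (div_nonneg ha hlam.le)
    have f2 := mul_le_mul_of_nonneg_right e2 (div_nonneg hb hlam.le)
    refine (add_le_add f1 f2).trans_eq ?_
    field_simp

end Params.Admissible

/-! ### One iteration of the algorithm -/

/-- Near a bound the barrier term forces the search direction inwards; away from it a short step
cannot reach the bound.  Here `s` is the distance to one bound, `c` is the contribution of the
opposite bound, and `M - μ * s⁻¹ + c` dominates the outward component of the barrier gradient. -/
theorem le_gap_sub {s c q h t M μ θ θ' Δ lam : ℝ} (hM : 0 < M) (hμ : 0 < μ) (hθ' : 0 < θ')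
    (hΔ : 0 < Δ) (hlam : 0 < lam) (hh : lam ≤ h) (hθθ' : θ ≤ θ') (hs : θ' ≤ s)
    (hq : q ≤ M - μ * s⁻¹ + c) (hc : c ≤ μ * θ'⁻¹) (hc' : s ≤ Δ / 2 → c ≤ 2 * μ / Δ)
    (ht0 : 0 ≤ t)
    (ht : t * (M + μ * θ'⁻¹) ≤ lam * ((1 / 2) * μ * Δ / (μ + (1 / 2) * M * Δ) - θ)) :
    θ ≤ s - t * (q / h) := by
  have hs0 := hθ'.trans_le hs
  set τ := (1 / 2) * μ * Δ / (μ + (1 / 2) * M * Δ) with hτ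
  have hτ0 : 0 < τ := by positivity
  have hτΔ : τ ≤ Δ / 2 := by
    rw [hτ, div_le_iff₀ (by positivity)]
    nlinarith [mul_pos hM hΔ, mul_pos (mul_pos hM hΔ) hΔ]
  have hh0 := hlam.trans_le hh
  rcases le_or_gt s τ with hsτ | hsτ
  · have h1 : M - μ * s⁻¹ + c ≤ 0 := by
      have h2 := hc' (hsτ.trans hτΔ)
      have h3 : μ * τ⁻¹ ≤ μ * s⁻¹ := by gcongr
      have h4 : μ * τ⁻¹ = M + 2 * μ / Δ := by
        rw [hτ]; field_simp; ring
      linarith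
    have : t * (q / h) ≤ 0 :=
      mul_nonpos_of_nonneg_of_nonpos ht0 (div_nonpos_of_nonpos_of_nonneg (hq.trans h1) hh0.le)
    linarith
  · have hB : 0 < M + μ * θ'⁻¹ := by positivity
    have h1 : q ≤ M + μ * θ'⁻¹ := by
      have : 0 < μ * s⁻¹ := by positivity
      linarith
    have h2 : q / h ≤ (M + μ * θ'⁻¹) / lam :=
      (div_le_div_of_nonneg_right h1 hh0.le).trans (div_le_div_of_nonneg_left hB.le hlam hh)
    have h3 : t * (q / h) ≤ τ - θ := by
      refine (mul_le_mul_of_nonneg_left h2 ht0).trans ?_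
      rw [← mul_div_assoc, div_le_iff₀ hlam]
      linarith
    linarith

namespace BoundProblem

variable {n : ℕ} {P : BoundProblem n} {p : Params}

theorem BoundsOK.gaps_pos (hP : P.BoundsOK) {θ : ℝ} (hθ : 0 < θ) {x : Vec n} (hx : x ∈ P.nbhd θ) :
    (∀ i ∈ P.lowerIdx, 0 < P.lowGap x i) ∧ ∀ i ∈ P.upperIdx, 0 < P.upGap x i := by
  rw [hP.mem_nbhd_iff] at hx
  exact ⟨fun i hi => hθ.trans_le (hx.1 i hi), fun i hi => hθ.trans_le (hx.2 i hi)⟩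

theorem BoundsOK.lip_le_lipK (hP : P.BoundsOK) (hp : p.Admissible P) {k : ℕ} (hk : 1 ≤ k)
    {θ θ' : ℝ} (hθ : 0 < θ) (hθ' : 0 < θ') {x x' : Vec n} (hx : x ∈ P.nbhd θ)
    (hx' : x' ∈ P.nbhd θ') : p.lip ≤ p.lipK P k x x' := by
  have h := hP.gaps_pos hθ hx
  have h' := hP.gaps_pos hθ' hx'
  have hμ := (hp.μ_pos hk).le
  have h1 := mul_nonneg hμ (minInv_nonneg h.1 h'.1)
  have h2 := mul_nonneg hμ (minInv_nonneg h.2 h'.2)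
  rw [Params.lipK, aInv_eq_minInv, bInv_eq_minInv]
  linarith

theorem BoundsOK.lipK_self_le (hP : P.BoundsOK) (hp : p.Admissible P) {k : ℕ} (hk : 1 ≤ k)
    {θ θ' : ℝ} (hθ : 0 < θ) (hθ' : 0 < θ') {x x' : Vec n} (hx : x ∈ P.nbhd θ)
    (hx' : x' ∈ P.nbhd θ') : p.lipK P k x x ≤ p.lipK P k x x' := by
  have h := hP.gaps_pos hθ hx
  have h' := hP.gaps_pos hθ' hx'
  have hμ := (hp.μ_pos hk).le
  have h1 := mul_le_mul_of_nonneg_left (minInv_self_le h.1 h'.1) hμ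
  have h2 := mul_le_mul_of_nonneg_left (minInv_self_le h.2 h'.2) hμ
  simp only [Params.lipK, aInv_eq_minInv, bInv_eq_minInv]
  linarith

theorem BoundsOK.lipK_le (hP : P.BoundsOK) (hp : p.Admissible P) {k : ℕ} (hk : 1 ≤ k)
    {θ : ℝ} (hθ : 0 < θ) {x x' : Vec n} (hx : x ∈ P.nbhd θ)
    (hx' : x' ∈ P.nbhd θ) : p.lipK P k x x' ≤ p.lip + 2 * p.μ k * (θ ^ 2)⁻¹ := by
  rw [hP.mem_nbhd_iff] at hx hx'
  have hμ := (hp.μ_pos hk).le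
  have h1 := mul_le_mul_of_nonneg_left (minInv_le_of_le hθ hx.1 hx'.1) hμ
  have h2 := mul_le_mul_of_nonneg_left (minInv_le_of_le hθ hx.2 hx'.2) hμ
  simp only [Params.lipK, aInv_eq_minInv, bInv_eq_minInv]
  linarith

end BoundProblem

namespace IsStep

variable {n : ℕ} {P : BoundProblem n} {p : Params} {k : ℕ} {x g q d xnext : Vec n}
  {H : Matrix (Fin n) (Fin n) ℝ} {γbar α γ : ℝ}

theorem lamMin_le (h : IsStep P p k x g q H d γbar α γ xnext) (i : Fin n) :
    p.lamMin k ≤ H i i := by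
  have := h.H_ge.diag_nonneg (i := i)
  simpa using this

theorem le_lamMax (h : IsStep P p k x g q H d γbar α γ xnext) (i : Fin n) :
    H i i ≤ p.lamMax k := by
  have := h.H_le.diag_nonneg (i := i)
  simpa using this

theorem H_pos (h : IsStep P p k x g q H d γbar α γ xnext) (hp : p.Admissible P) (hk : 1 ≤ k)
    (i : Fin n) : 0 < H i i :=
  (hp.lamMin_pos hk).trans_le (h.lamMin_le i)

theorem inv_eq (h : IsStep P p k x g q H d γbar α γ xnext) (hp : p.Admissible P) (hk : 1 ≤ k) :
    H⁻¹ = Matrix.diagonal fun i => (H i i)⁻¹ := by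
  refine Matrix.inv_eq_right_inv ?_
  nth_rewrite 1 [← h.H_diag.diagonal_diag]
  rw [Matrix.diagonal_mul_diagonal, ← Matrix.diagonal_one]
  congr 1
  ext i
  exact mul_inv_cancel₀ (h.H_pos hp hk i).ne'

theorem normSqInv_eq (h : IsStep P p k x g q H d γbar α γ xnext) (hp : p.Admissible P)
    (hk : 1 ≤ k) (v : Vec n) : normSqInv H v = ∑ i, v i ^ 2 / H i i := by
  rw [normSqInv, h.inv_eq hp hk, dotProduct]
  refine Finset.sum_congr rfl fun i _ => ?_
  rw [Matrix.mulVec_diagonal]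
  ring

theorem d_apply (h : IsStep P p k x g q H d γbar α γ xnext) (hp : p.Admissible P)
    (hk : 1 ≤ k) (i : Fin n) : d i = -(q i / H i i) := by
  rw [h.d_eq, h.inv_eq hp hk]
  simp only [PiLp.neg_apply, Matrix.mulVec_diagonal]
  ring

theorem xnext_mem (h : IsStep P p k x g q H d γbar α γ xnext) : xnext ∈ P.nbhd (p.θ k) :=
  h.xnext_eq ▸ h.γ_max.1.2.2

theorem αpre_pos (hp : p.Admissible P) (hP : P.BoundsOK) (hℓ : 0 < p.lip) (hk : 1 ≤ k)
    (hx : x ∈ P.nbhd (p.θ (k - 1))) : 0 < p.αpre P k x := by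
  have hθ := hp.θ_pos (k - 1)
  exact div_pos (mul_pos (hp.lamMin_pos hk) (natCast_rpow_pos hk _))
    (hℓ.trans_le (hP.lip_le_lipK hp hk hθ hθ hx hx))

theorem αmin_le_α (h : IsStep P p k x g q H d γbar α γ xnext) (hp : p.Admissible P)
    (hP : P.BoundsOK) (hℓ : 0 < p.lip) (hk : 1 ≤ k) (hx : x ∈ P.nbhd (p.θ (k - 1))) :
    p.αmin k ≤ α := by
  have hθ := hp.θ_pos k
  have hx' := hP.nbhd_anti (hp.θ_le_pred hk) hx
  rw [h.α_eq]
  refine le_min ?_ (hp.αmin_le_αmax hk)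
  exact div_le_div_of_nonneg_left (mul_pos (hp.lamMin_pos hk) (natCast_rpow_pos hk _)).le
    (hℓ.trans_le (hP.lip_le_lipK hp hk hθ hθ hx' h.γbar_max.1.2.2))
    (hP.lipK_le hp hk hθ hx' h.γbar_max.1.2.2)

theorem α_le_αmax (h : IsStep P p k x g q H d γbar α γ xnext) : α ≤ p.αmax k :=
  h.α_eq ▸ min_le_right _ _

theorem α_mul_lipK_le (h : IsStep P p k x g q H d γbar α γ xnext) (hp : p.Admissible P)
    (hP : P.BoundsOK) (hℓ : 0 < p.lip) (hk : 1 ≤ k) (hx : x ∈ P.nbhd (p.θ (k - 1))) :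
    α * p.lipK P k x (x + (γbar * p.αpre P k x) • d) ≤ p.lamMin k * (k : ℝ) ^ p.tα := by
  have hL := hℓ.trans_le (hP.lip_le_lipK hp hk (hp.θ_pos _) (hp.θ_pos k) hx h.γbar_max.1.2.2)
  rw [← le_div_iff₀ hL, h.α_eq]
  exact min_le_left _ _

theorem α_le_αpre (h : IsStep P p k x g q H d γbar α γ xnext) (hp : p.Admissible P)
    (hP : P.BoundsOK) (hℓ : 0 < p.lip) (hk : 1 ≤ k) (hx : x ∈ P.nbhd (p.θ (k - 1))) :
    α ≤ p.αpre P k x := by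
  have hθ := hp.θ_pos (k - 1)
  rw [h.α_eq]
  refine (min_le_left _ _).trans ?_
  exact div_le_div_of_nonneg_left (mul_pos (hp.lamMin_pos hk) (natCast_rpow_pos hk _)).le
    (hℓ.trans_le (hP.lip_le_lipK hp hk hθ hθ hx hx))
    (hP.lipK_self_le hp hk hθ (hp.θ_pos k) hx h.γbar_max.1.2.2)

/-- The step that is taken never exceeds the trial step, so that the next iterate lies on the
segment from the iterate to the trial point. -/
theorem γ_mul_α_le (h : IsStep P p k x g q H d γbar α γ xnext) (hp : p.Admissible P)
    (hP : P.BoundsOK) (hℓ : 0 < p.lip) (hk : 1 ≤ k) (hx : x ∈ P.nbhd (p.θ (k - 1))) :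
    γ * α ≤ γbar * p.αpre P k x := by
  have hpre := αpre_pos hp hP hℓ hk hx
  have hα := (hp.αmin_pos hℓ hk).trans_le (h.αmin_le_α hp hP hℓ hk hx)
  have hγ := h.γ_max.1.1
  rw [← div_le_iff₀ hpre]
  refine h.γbar_max.2 ⟨by positivity, ?_, ?_⟩
  · rw [div_le_iff₀ hpre]
    exact mul_le_mul h.γ_max.1.2.1 (h.α_le_αpre hp hP hℓ hk hx) hα.le
      (hγ.le.trans h.γ_max.1.2.1)
  · rw [div_mul_cancel₀ _ hpre.ne']
    exact h.γ_max.1.2.2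

/-- A step fraction of `γmin` keeps the iterate in the next neighborhood, whatever the gradient
estimate is, as long as its entries are bounded by `κ∞ + σ∞`. -/
theorem γmin_le_γ (h : IsStep P p k x g q H d γbar α γ xnext) (hp : p.Admissible P)
    (hP : P.BoundsOK) (hℓ : 0 < p.lip) (hκ : 0 < p.kappaInf) (hk : 1 ≤ k)
    (hx : x ∈ P.nbhd (p.θ (k - 1))) (hg : ∀ i, |g i| ≤ p.kappaInf + p.sigmaInf) :
    p.γmin P k ≤ γ := by
  have hγm := hp.γmin_pos hℓ hκ hk
  have hα := (hp.αmin_pos hℓ hk).trans_le (h.αmin_le_α hp hP hℓ hk hx)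
  have hαmax := hp.αmax_pos hℓ hk
  have hM : 0 < p.kappaInf + p.sigmaInf := by linarith [hp.sigmaInf_nonneg]
  have hμ := hp.μ_pos hk
  have hlam := hp.lamMin_pos hk
  have hw := hp.width_pos
  have hθ' := hp.θ_pos (k - 1)
  have ht : p.γmin P k * α * (p.kappaInf + p.sigmaInf + p.μ k * (p.θ (k - 1))⁻¹) ≤
      p.lamMin k * ((1 / 2) * p.μ k * P.width p.Δbar /
        (p.μ k + (1 / 2) * (p.kappaInf + p.sigmaInf) * P.width p.Δbar) - p.θ k) := by
    have hB : 0 < p.kappaInf + p.sigmaInf + p.μ k * (p.θ (k - 1))⁻¹ := by positivity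
    have h1 : p.γmin P k ≤ _ := min_le_right _ _
    rw [le_div_iff₀ (by positivity)] at h1
    refine le_trans ?_ h1
    rw [mul_assoc]
    gcongr
    exact h.α_le_αmax
  refine h.γ_max.2 ⟨hγm, hp.γmin_le_γmax hk, ?_⟩
  rw [hP.mem_nbhd_iff] at hx ⊢
  have hqi : ∀ i, q i = P.barrierEstimate g x (p.μ k) i := fun i => by rw [h.q_eq]
  -- the opposite bound contributes at most `2 * μ / Δ` on the half of the interval next to a bound
  have opp : ∀ s s' : ℝ, p.θ (k - 1) ≤ s' → P.width p.Δbar ≤ s + s' →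
      p.μ k * s'⁻¹ ≤ p.μ k * (p.θ (k - 1))⁻¹ ∧
      (s ≤ P.width p.Δbar / 2 → p.μ k * s'⁻¹ ≤ 2 * p.μ k / P.width p.Δbar) := by
    intro s s' hs' hss'
    refine ⟨by gcongr, fun hs => ?_⟩
    have : P.width p.Δbar / 2 ≤ s' := by linarith
    calc p.μ k * s'⁻¹ ≤ p.μ k * (P.width p.Δbar / 2)⁻¹ := by gcongr
      _ = _ := by field_simp
  constructor
  · intro i hi
    have e : P.lowGap (x + (p.γmin P k * α) • d) i =
        P.lowGap x i - p.γmin P k * α * (q i / H i i) := by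
      simp only [BoundProblem.lowGap, PiLp.add_apply, PiLp.smul_apply, smul_eq_mul,
        h.d_apply hp hk i]
      ring
    rw [e]
    have hgi := (abs_le.1 (hg i)).2
    refine le_gap_sub (c := if i ∈ P.upperIdx then p.μ k * (P.upGap x i)⁻¹ else 0) hM hμ hθ' hw hlam
      (h.lamMin_le i) (hp.θ_le_pred hk) (hx.1 i hi) ?_ ?_ ?_ (by positivity) ht
    · rw [hqi]; simp only [BoundProblem.barrierEstimate, hi, if_true]; gcongr
    · split_ifs with hu
      · exact (opp _ _ (hx.2 i hu) (hP.width_le hw hi hu x)).1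
      · positivity
    · split_ifs with hu
      · exact (opp _ _ (hx.2 i hu) (hP.width_le hw hi hu x)).2
      · intro _; positivity
  · intro i hi
    have e : P.upGap (x + (p.γmin P k * α) • d) i =
        P.upGap x i - p.γmin P k * α * (-q i / H i i) := by
      simp only [BoundProblem.upGap, PiLp.add_apply, PiLp.smul_apply, smul_eq_mul,
        h.d_apply hp hk i]
      ring
    rw [e]
    have hgi := (abs_le.1 (hg i)).1
    refine le_gap_sub (c := if i ∈ P.lowerIdx then p.μ k * (P.lowGap x i)⁻¹ else 0) hM hμ hθ' hw hlam
      (h.lamMin_le i) (hp.θ_le_pred hk) (hx.2 i hi) ?_ ?_ ?_ (by positivity) ht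
    · rw [hqi]; simp only [BoundProblem.barrierEstimate, hi, if_true]; linarith
    · split_ifs with hu
      · exact (opp _ _ (hx.1 i hu) ((hP.width_le hw hu hi x).trans_eq (add_comm _ _))).1
      · positivity
    · split_ifs with hu
      · exact (opp _ _ (hx.1 i hu) ((hP.width_le hw hu hi x).trans_eq (add_comm _ _))).2
      · intro _; positivity

theorem barrier_xnext_le (h : IsStep P p k x g q H d γbar α γ xnext) (hp : p.Admissible P)
    (hP : P.BoundsOK) (hf : P.ObjectiveOK p.lip p.kappa2 p.kappaInf) (hk : 1 ≤ k)
    (hx : x ∈ P.nbhd (p.θ (k - 1))) {χ : ℝ} (hχ : 0 < χ) :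
    P.barrier χ xnext (p.μ k) ≤ P.barrier χ x (p.μ k)
      + γ * α * inner ℝ (P.barrierEstimate (∇ P.f x) x (p.μ k)) d
      + p.lamMin k * (k : ℝ) ^ p.tα / 2 * (γ * α) * ‖d‖ ^ 2 := by
  have hℓ := hf.lip_pos
  have hα := (hp.αmin_pos hℓ hk).trans_le (h.αmin_le_α hp hP hℓ hk hx)
  have hγ := h.γ_max.1.1
  have hγ1 : γ ≤ 1 := h.γ_max.1.2.1.trans (min_le_left _ _)
  have hs := h.γ_mul_α_le hp hP hℓ hk hx
  have hθ := hp.θ_pos k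
  have hx' := hP.nbhd_anti (hp.θ_le_pred hk) hx
  have hbar := h.γbar_max.1.2.2
  have hgx := hP.gaps_pos hθ hx'
  have hgb := hP.gaps_pos hθ hbar
  have hαl := h.α_mul_lipK_le hp hP hℓ hk hx
  set xb := x + (γbar * p.αpre P k x) • d with hxb
  set s := γ * α with hsdef
  have hs0 : 0 ≤ s := by positivity
  -- a coordinate of `xnext` lies between those of `x` and of the trial point
  have seg : ∀ a b : ℝ, min a (a + γbar * p.αpre P k x * b) ≤ a + s * b := by
    intro a b
    rcases le_total 0 b with hb | hb
    · exact (min_le_left _ _).trans (by nlinarith)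
    · exact (min_le_right _ _).trans (by nlinarith)
  have hb := hP.barrier_le hf hχ hθ (hp.μ_pos hk).le hx' h.xnext_mem
    (BoundProblem.minInv_nonneg hgx.1 hgb.1) (BoundProblem.minInv_nonneg hgx.2 hgb.2)
    (by
      intro i hi
      refine le_trans (inv_anti₀ (mul_pos (hgx.1 i hi) (lt_min (hgx.1 i hi) (hgb.1 i hi))) ?_)
        (BoundProblem.inv_le_minInv hgx.1 hgb.1 hi)
      refine mul_le_mul_of_nonneg_left (le_min (min_le_left _ _) ?_) (hgx.1 i hi).le
      have := seg (P.lowGap x i) (d i)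
      rw [h.xnext_eq, hxb]
      simp only [BoundProblem.lowGap, PiLp.add_apply, PiLp.smul_apply, smul_eq_mul] at this ⊢
      refine le_of_eq_of_le ?_ (this.trans_eq (by rw [hsdef]; ring))
      congr 1; ring)
    (by
      intro i hi
      refine le_trans (inv_anti₀ (mul_pos (hgx.2 i hi) (lt_min (hgx.2 i hi) (hgb.2 i hi))) ?_)
        (BoundProblem.inv_le_minInv hgx.2 hgb.2 hi)
      refine mul_le_mul_of_nonneg_left (le_min (min_le_left _ _) ?_) (hgx.2 i hi).le
      have := seg (P.upGap x i) (-d i)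
      rw [h.xnext_eq, hxb]
      simp only [BoundProblem.upGap, PiLp.add_apply, PiLp.smul_apply, smul_eq_mul] at this ⊢
      refine le_of_eq_of_le ?_ (this.trans_eq (by rw [hsdef]; ring))
      congr 1; ring)
  have hdiff : xnext - x = s • d := by rw [h.xnext_eq, add_sub_cancel_left]
  rw [hdiff, inner_smul_right, norm_smul, Real.norm_of_nonneg hs0] at hb
  refine hb.trans ?_
  have hL : p.lip + p.μ k * BoundProblem.minInv P.lowerIdx (P.lowGap x) (P.lowGap xb) +
      p.μ k * BoundProblem.minInv P.upperIdx (P.upGap x) (P.upGap xb) = p.lipK P k x xb := rfl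
  rw [hL]
  have h1 : s * p.lipK P k x xb ≤ p.lamMin k * (k : ℝ) ^ p.tα := by
    have hLpos := hℓ.trans_le (hP.lip_le_lipK hp hk hθ hθ hx' hbar)
    refine le_trans ?_ hαl
    rw [hsdef, mul_assoc]
    exact mul_le_of_le_one_left (by positivity) hγ1
  have h2 := mul_le_mul_of_nonneg_right h1 (by positivity : 0 ≤ s * ‖d‖ ^ 2)
  nlinarith

/-- Decrease of the barrier function in one step, in terms of the true barrier gradient `v` and of
the gradient error `e`.  The random step length `γ * α` is replaced by the deterministic length
`γmin * αmin` in the terms that are linear in `v`; the replacement costs the last two terms. -/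
theorem decrease (h : IsStep P p k x g q H d γbar α γ xnext) (hp : p.Admissible P)
    (hP : P.BoundsOK) (hf : P.ObjectiveOK p.lip p.kappa2 p.kappaInf) (hk : 1 ≤ k)
    (hx : x ∈ P.nbhd (p.θ (k - 1))) {χ : ℝ} (hχ : 0 < χ)
    (hg : ∀ i, |g i| ≤ p.kappaInf + p.sigmaInf) {v e : Vec n}
    (hv : v = P.barrierEstimate (∇ P.f x) x (p.μ k)) (he : e = g - ∇ P.f x) :
    P.barrier χ xnext (p.μ k) ≤ P.barrier χ x (p.μ k)
      - p.γmin P k * p.αmin k / 2 * (∑ i, v i ^ 2 / H i i)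
      - p.γmin P k * p.αmin k * (1 - (k : ℝ) ^ p.tα) * (∑ i, v i / H i i * e i)
      + (p.γmax P k * p.αmax k - p.γmin P k * p.αmin k) * |∑ i, v i / H i i * e i|
      + (k : ℝ) ^ p.tα * (p.γmax P k * p.αmax k) / 2 * (∑ i, e i ^ 2 / H i i) := by
  have hℓ := hf.lip_pos
  have hκ := hf.kappaInf_pos
  have hb := h.barrier_xnext_le hp hP hf hk hx hχ
  rw [← hv] at hb
  have hH := h.H_pos hp hk
  have hz0 := natCast_rpow_pos hk p.tα
  have hz1 := natCast_rpow_le_one hk hp.tα_neg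
  have hq : ∀ i, q i = v i + e i := by
    intro i
    rw [h.q_eq, hv, he]
    simp only [BoundProblem.barrierEstimate, PiLp.sub_apply]
    ring
  have hvd : inner ℝ v d = -(∑ i, v i ^ 2 / H i i) - ∑ i, v i / H i i * e i := by
    rw [PiLp.inner_apply, ← Finset.sum_neg_distrib, ← Finset.sum_sub_distrib]
    refine Finset.sum_congr rfl fun i _ => ?_
    rw [h.d_apply hp hk i, hq i]
    simp only [RCLike.inner_apply, conj_trivial]
    ring
  have hdd : p.lamMin k * ‖d‖ ^ 2 ≤ (∑ i, v i ^ 2 / H i i) + 2 * (∑ i, v i / H i i * e i)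
      + ∑ i, e i ^ 2 / H i i := by
    rw [EuclideanSpace.real_norm_sq_eq, Finset.mul_sum, Finset.mul_sum, ← Finset.sum_add_distrib,
      ← Finset.sum_add_distrib]
    refine Finset.sum_le_sum fun i _ => ?_
    have hi := hH i
    calc p.lamMin k * d i ^ 2 ≤ H i i * d i ^ 2 :=
          mul_le_mul_of_nonneg_right (h.lamMin_le i) (sq_nonneg _)
      _ = _ := by rw [h.d_apply hp hk i, hq i]; field_simp; ring
  have hVV : 0 ≤ ∑ i, v i ^ 2 / H i i :=
    Finset.sum_nonneg fun i _ => div_nonneg (sq_nonneg _) (hH i).le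
  have hEE : 0 ≤ ∑ i, e i ^ 2 / H i i :=
    Finset.sum_nonneg fun i _ => div_nonneg (sq_nonneg _) (hH i).le
  rw [hvd] at hb
  have hγ := h.γmin_le_γ hp hP hℓ hκ hk hx hg
  have hα := h.αmin_le_α hp hP hℓ hk hx
  have hγm := hp.γmin_pos hℓ hκ hk
  have hαm := hp.αmin_pos hℓ hk
  have hs1 : p.γmin P k * p.αmin k ≤ γ * α := mul_le_mul hγ hα hαm.le (hγm.le.trans hγ)
  have hs2 : γ * α ≤ p.γmax P k * p.αmax k :=
    mul_le_mul h.γ_max.1.2.1 h.α_le_αmax (hαm.le.trans hα)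
      (hγm.le.trans (hp.γmin_le_γmax hk))
  have hw0 : 0 < p.γmin P k * p.αmin k := mul_pos hγm hαm
  generalize ∑ i, v i ^ 2 / H i i = VV at *
  generalize ∑ i, v i / H i i * e i = VE at *
  generalize ∑ i, e i ^ 2 / H i i = EE at *
  generalize p.γmin P k * p.αmin k = w at *
  generalize p.γmax P k * p.αmax k = W at *
  generalize γ * α = s at *
  generalize (k : ℝ) ^ p.tα = z at *
  have hs0 : 0 < s := hw0.trans_le hs1
  have i1 := mul_le_mul_of_nonneg_left hdd (by positivity : 0 ≤ z / 2 * s)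
  -- `z ≤ 1` gives `s * (1 - z / 2) ≥ w / 2`
  have i2 : w / 2 * VV ≤ s * (1 - z / 2) * VV := by
    refine mul_le_mul_of_nonneg_right ?_ hVV
    nlinarith
  have i3 : -(s * (1 - z) * VE) ≤ -(w * (1 - z) * VE) + (W - w) * |VE| := by
    have j1 : -((s - w) * (1 - z) * VE) ≤ (s - w) * (1 - z) * |VE| := by
      rw [← mul_neg]
      exact mul_le_mul_of_nonneg_left (neg_le_abs VE)
        (mul_nonneg (sub_nonneg.2 hs1) (sub_nonneg.2 hz1))
    have j2 : (s - w) * (1 - z) * |VE| ≤ (W - w) * |VE| := by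
      refine mul_le_mul_of_nonneg_right ?_ (abs_nonneg _)
      nlinarith
    nlinarith
  have i4 : z / 2 * s * EE ≤ z * W / 2 * EE := by
    refine mul_le_mul_of_nonneg_right ?_ hEE
    nlinarith
  nlinarith

end IsStep

/-! ### Measurability of one iteration -/

section Measurability

variable {n : ℕ} {P : BoundProblem n} {p : Params} {Ω : Type*} [MeasurableSpace Ω]

theorem measurable_vec {f : Ω → Vec n} (h : ∀ i, Measurable fun ω => f ω i) : Measurable f :=
  (WithLp.measurable_toLp 2 (Fin n → ℝ)).comp (measurable_pi_iff.2 h)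

theorem measurable_coord {f : Ω → Vec n} (h : Measurable f) (i : Fin n) :
    Measurable fun ω => f ω i :=
  (by fun_prop : Continuous fun x : Vec n => x i).measurable.comp h

theorem measurable_gradient (f : Vec n → ℝ) : Measurable (∇ f) :=
  (InnerProductSpace.toDual ℝ (Vec n)).symm.continuous.measurable.comp (measurable_fderiv ℝ f)

theorem measurable_minInv {s : Finset (Fin n)} {g g' : Ω → Fin n → ℝ}
    (hg : ∀ i, Measurable fun ω => g ω i) (hg' : ∀ i, Measurable fun ω => g' ω i) :
    Measurable fun ω => BoundProblem.minInv s (g ω) (g' ω) := by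
  by_cases h : s.Nonempty
  · simp only [BoundProblem.minInv, dif_pos h]
    have h1 : Measurable (s.inf' h fun i ω => g ω i * min (g ω i) (g' ω i)) :=
      Finset.inf'_induction h _ (fun _ h1 _ h2 => h1.inf h2)
        fun i _ => (hg i).mul ((hg i).min (hg' i))
    convert h1.inv using 1
    ext ω
    simp [Finset.inf'_apply]
  · simp only [BoundProblem.minInv, dif_neg h]
    exact measurable_const

theorem measurable_barrierEstimate {g x : Ω → Vec n} (hg : Measurable g) (hx : Measurable x)
    (μ : ℝ) : Measurable fun ω => P.barrierEstimate (g ω) (x ω) μ := by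
  refine measurable_vec fun i => ?_
  simp only [BoundProblem.barrierEstimate]
  refine ((measurable_coord hg i).sub ?_).add ?_
  · split_ifs
    · exact (((P.continuous_lowGap i).measurable.comp hx).inv).const_mul μ
    · exact measurable_const
  · split_ifs
    · exact (((P.continuous_upGap i).measurable.comp hx).inv).const_mul μ
    · exact measurable_const

theorem measurable_lipK {x x' : Ω → Vec n} (hx : Measurable x) (hx' : Measurable x') (k : ℕ) :
    Measurable fun ω => p.lipK P k (x ω) (x' ω) := by
  unfold Params.lipK
  simp only [BoundProblem.aInv_eq_minInv, BoundProblem.bInv_eq_minInv]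
  have hl := fun i => P.continuous_lowGap i |>.measurable
  have hu := fun i => P.continuous_upGap i |>.measurable
  exact ((measurable_minInv (fun i => (hl i).comp hx) fun i => (hl i).comp hx').const_mul _
    |>.const_add _).add
    ((measurable_minInv (fun i => (hu i).comp hx) fun i => (hu i).comp hx').const_mul _)

/-- Maximal step fractions are measurable: by convexity of the neighborhood, the maximum is at least
`b > 0` exactly if the fraction `b` itself is admissible. -/
theorem measurable_of_isGreatest (hP : P.BoundsOK) {θ c : ℝ} {x d : Ω → Vec n} {a T : Ω → ℝ}
    (hx : Measurable x) (hd : Measurable d) (ha : Measurable a) (hmem : ∀ ω, x ω ∈ P.nbhd θ)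
    (hT : ∀ ω, IsGreatest {s : ℝ | 0 < s ∧ s ≤ c ∧ x ω + (s * a ω) • d ω ∈ P.nbhd θ} (T ω)) :
    Measurable T := by
  refine measurable_of_Ici fun b => ?_
  rcases le_or_gt b 0 with hb | hb
  · convert MeasurableSet.univ
    ext ω
    simpa using hb.trans (hT ω).1.1.le
  · have e : T ⁻¹' Set.Ici b = {ω | b ≤ c} ∩ (fun ω => x ω + (b * a ω) • d ω) ⁻¹' P.nbhd θ := by
      ext ω
      constructor
      · intro h
        have hbT : b ≤ T ω := h
        obtain ⟨h0, h1, h2⟩ := (hT ω).1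
        refine ⟨hbT.trans h1, ?_⟩
        have := (hP.convex_nbhd θ).add_smul_mem (hmem ω) h2
          (t := b / T ω) ⟨by positivity, (div_le_one h0).2 hbT⟩
        rw [smul_smul, ← mul_assoc, div_mul_cancel₀ _ h0.ne'] at this
        exact this
      · rintro ⟨h1, h2⟩
        exact (hT ω).2 ⟨hb, h1, h2⟩
    rw [e]
    refine (MeasurableSet.const _).inter ?_
    exact (hx.add ((ha.const_mul b).smul hd)) (hP.isClosed_nbhd θ).measurableSet

theorem IsStep.measurable_xnext (hP : P.BoundsOK) (hp : p.Admissible P) {k : ℕ} (hk : 1 ≤ k)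
    {x g q d xnext : Ω → Vec n} {H : Ω → Matrix (Fin n) (Fin n) ℝ} {γbar α γ : Ω → ℝ}
    (h : ∀ ω, IsStep P p k (x ω) (g ω) (q ω) (H ω) (d ω) (γbar ω) (α ω) (γ ω) (xnext ω))
    (hmem : ∀ ω, x ω ∈ P.nbhd (p.θ (k - 1)))
    (hx : Measurable x) (hg : Measurable g) (hH : ∀ i j, Measurable fun ω => H ω i j) :
    Measurable xnext := by
  have hq : Measurable q := by
    rw [funext fun ω => (h ω).q_eq]
    exact measurable_barrierEstimate hg hx _
  have hd : Measurable d := by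
    refine measurable_vec fun i => ?_
    rw [funext fun ω => (h ω).d_apply hp hk i]
    exact ((measurable_coord hq i).div (hH i i)).neg
  have hpre : Measurable fun ω => p.αpre P k (x ω) :=
    (measurable_lipK hx hx k).const_div _
  have hmem' := fun ω => hP.nbhd_anti (hp.θ_le_pred hk) (hmem ω)
  have hγbar : Measurable γbar :=
    measurable_of_isGreatest hP hx hd hpre hmem' fun ω => (h ω).γbar_max
  have hα : Measurable α := by
    rw [funext fun ω => (h ω).α_eq]
    exact ((measurable_lipK hx (hx.add ((hγbar.mul hpre).smul hd)) k).const_div _).min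
      measurable_const
  have hγ : Measurable γ :=
    measurable_of_isGreatest hP hx hd hα hmem' fun ω => (h ω).γ_max
  rw [funext fun ω => (h ω).xnext_eq]
  exact hx.add ((hγ.mul hα).smul hd)

end Measurability

/-! ### Expectations and limits inferior -/

/-- A bounded predictable vector is orthogonal in expectation to a centered noise vector. -/
theorem integral_inner_sub_condExp {n : ℕ} {Ω : Type*} {m mΩ : MeasurableSpace Ω} (hm : m ≤ mΩ)
    {ℙ : Measure Ω} [IsProbabilityMeasure ℙ] {u g e : Ω → Vec n} {C : ℝ}
    (hu : Measurable[m] u) (hC : ∀ ω, ‖u ω‖ ≤ C) (hg : Integrable g ℙ)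
    (he : e =ᵐ[ℙ] fun ω => g ω - ℙ[g | m] ω) :
    Integrable (fun ω => inner ℝ (u ω) (e ω)) ℙ ∧ ∫ ω, inner ℝ (u ω) (e ω) ∂ℙ = 0 := by
  have hint : ∀ f : Ω → Vec n, Integrable f ℙ → Integrable (fun ω => inner ℝ (u ω) (f ω)) ℙ := by
    intro f hf
    refine (hf.norm.const_mul C).mono' ?_ (ae_of_all _ fun ω => ?_)
    · exact (hu.mono hm le_rfl).aestronglyMeasurable.inner hf.aestronglyMeasurable
    · exact (norm_inner_le_norm _ _).trans (mul_le_mul_of_nonneg_right (hC ω) (norm_nonneg _))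
  have h1 := condExp_bilin_of_stronglyMeasurable_left (μ := ℙ) (m := m) (innerSL ℝ (E := Vec n))
    hu.stronglyMeasurable (hint g hg) hg
  have h2 := integral_congr_ae h1
  rw [integral_condExp hm] at h2
  change ∫ ω, inner ℝ (u ω) (g ω) ∂ℙ = ∫ ω, inner ℝ (u ω) (ℙ[g | m] ω) ∂ℙ at h2
  have h3 : (fun ω => (inner ℝ (u ω) (e ω) : ℝ)) =ᵐ[ℙ]
      fun ω => inner ℝ (u ω) (g ω) - inner ℝ (u ω) (ℙ[g | m] ω) := by
    filter_upwards [he] with ω hω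
    rw [hω, inner_sub_right]
  refine ⟨((hint g hg).sub (hint _ integrable_condExp)).congr h3.symm, ?_⟩
  rw [integral_congr_ae h3, integral_sub (hint g hg) (hint _ integrable_condExp), h2, sub_self]

theorem ae_summable_of_sum_integral_le {Ω : Type*} [MeasurableSpace Ω] {ℙ : Measure Ω}
    {f : ℕ → Ω → ℝ} {C : ℝ} (h0 : ∀ k ω, 0 ≤ f k ω) (hf : ∀ k, Integrable (f k) ℙ)
    (hC : ∀ K, ∑ k ∈ Finset.range K, ∫ ω, f k ω ∂ℙ ≤ C) :
    ∀ᵐ ω ∂ℙ, Summable fun k => f k ω := by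
  have hm : ∀ k, AEMeasurable (fun ω => ENNReal.ofReal (f k ω)) ℙ := fun k =>
    (hf k).aestronglyMeasurable.aemeasurable.ennreal_ofReal
  have hfin : ∫⁻ ω, ∑' k, ENNReal.ofReal (f k ω) ∂ℙ ≠ ⊤ := by
    rw [lintegral_tsum hm]
    refine ne_top_of_le_ne_top (ENNReal.ofReal_ne_top (r := C))
      (ENNReal.tsum_le_of_sum_range_le fun K => ?_)
    simp only [← ofReal_integral_eq_lintegral_ofReal (hf _) (ae_of_all _ (h0 _))]
    rw [← ENNReal.ofReal_sum_of_nonneg fun k _ => integral_nonneg (h0 k)]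
    exact ENNReal.ofReal_le_ofReal (hC K)
  filter_upwards [ae_lt_top' (AEMeasurable.tsum hm) hfin] with ω hω
  simpa [ENNReal.toReal_ofReal (h0 _ ω)] using ENNReal.summable_toReal hω.ne

theorem liminf_eq_zero_of_summable {N w : ℕ → ℝ} {c : ℝ} (hN : ∀ k, 1 ≤ k → 0 ≤ N k) (hc : 0 < c)
    (hw : ∀ k : ℕ, 1 ≤ k → c * (k : ℝ)⁻¹ ≤ w k)
    (hs : Summable fun k => w (k + 1) * N (k + 1)) :
    liminf (fun k => ((N k : ℝ) : EReal)) atTop = 0 := by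
  refine le_antisymm (le_of_not_gt fun hpos => ?_) ?_
  · obtain ⟨ε, h0, hε⟩ := EReal.lt_iff_exists_real_btwn.1 hpos
    have h0 : 0 < ε := by exact_mod_cast h0
    have hev : ∀ᶠ k in atTop, ε < N k := by
      filter_upwards [eventually_lt_of_lt_liminf hε] with k hk
      exact_mod_cast hk
    obtain ⟨K, hK⟩ := eventually_atTop.1 hev
    refine Real.not_summable_natCast_inv ?_
    rw [← summable_nat_add_iff (K + 1)]
    have hs' := ((summable_nat_add_iff K).2 hs).mul_left (c * ε)⁻¹
    refine hs'.of_nonneg_of_le (fun k => by positivity) fun k => ?_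
    have h1 := hw (k + K + 1) (by omega)
    have h2 := hK (k + K + 1) (by omega)
    rw [le_inv_mul_iff₀ (by positivity)]
    rw [show k + (K + 1) = k + K + 1 by ring]
    have h3 := mul_le_mul h1 h2.le h0.le (le_trans (by positivity) h1)
    linarith
  · refine le_liminf_of_le (by isBoundedDefault) ?_
    filter_upwards [eventually_ge_atTop 1] with k hk
    exact_mod_cast hN k hk

/-! ### Limits of barrier-stationary iterates -/

namespace BoundProblem

variable {n : ℕ} {P : BoundProblem n} {p : Params}

/-- Limit points along which the barrier gradient vanishes are KKT points.  At an active bound the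
barrier terms of the opposite bound vanish, so the multiplier estimate `μ k / gap` converges to
`± ∇ f`; at an inactive bound it converges to zero. -/
theorem BoundsOK.isKKT_of_tendsto (hP : P.BoundsOK) {ℓ κ₂ κinf : ℝ} (hf : P.ObjectiveOK ℓ κ₂ κinf)
    {χ : ℝ} (hχ : 0 < χ) {x : ℕ → Vec n} {μ θ : ℕ → ℝ} {F : Filter ℕ} [F.NeBot]
    (hx : ∀ᶠ k in F, 0 < μ k ∧ 0 < θ k ∧ x k ∈ P.nbhd (θ k)) (hμ : Tendsto μ F (𝓝 0))
    {xbar : Vec n} (hxbar : xbar ∈ P.feasible)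
    (hgrad : Tendsto (fun k => P.barrierGrad χ (x k) (μ k)) F (𝓝 0))
    (hlim : Tendsto x F (𝓝 xbar)) : P.IsKKT xbar := by
  classical
  have hgap := hxbar
  rw [feasible_eq_nbhd_zero, hP.mem_nbhd_iff] at hgap
  have hlow : ∀ i, ¬(i ∈ P.lowerIdx ∧ P.lowGap xbar i = 0) →
      Tendsto (fun k => if i ∈ P.lowerIdx then μ k * (P.lowGap (x k) i)⁻¹ else 0) F (𝓝 0) := by
    intro i hi
    split_ifs with h
    · have h0 : P.lowGap xbar i ≠ 0 := fun h0 => hi ⟨h, h0⟩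
      have h1 := (((continuous_lowGap i).tendsto xbar).comp hlim).inv₀ h0
      simpa using hμ.mul h1
    · exact tendsto_const_nhds
  have hup : ∀ i, ¬(i ∈ P.upperIdx ∧ P.upGap xbar i = 0) →
      Tendsto (fun k => if i ∈ P.upperIdx then μ k * (P.upGap (x k) i)⁻¹ else 0) F (𝓝 0) := by
    intro i hi
    split_ifs with h
    · have h0 : P.upGap xbar i ≠ 0 := fun h0 => hi ⟨h, h0⟩
      have h1 := (((continuous_upGap i).tendsto xbar).comp hlim).inv₀ h0
      simpa using hμ.mul h1
    · exact tendsto_const_nhds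
  have hG : ∀ i, Tendsto (fun k => ∇ P.f (x k) i) F (𝓝 (∇ P.f xbar i)) := fun i =>
    ((by fun_prop : Continuous fun y : Vec n => y i).tendsto _).comp
      ((hf.continuousAt_gradient hxbar).tendsto.comp hlim)
  have hV : ∀ i, Tendsto (fun k => ∇ P.f (x k) i
      - (if i ∈ P.lowerIdx then μ k * (P.lowGap (x k) i)⁻¹ else 0)
      + (if i ∈ P.upperIdx then μ k * (P.upGap (x k) i)⁻¹ else 0)) F (𝓝 0) := by
    intro i
    have h1 := ((by fun_prop : Continuous fun y : Vec n => y i).tendsto _).comp hgrad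
    refine Tendsto.congr' ?_ h1
    filter_upwards [hx] with k hk
    simp only [Function.comp_apply, hP.barrierGrad_eq hf hχ hk.2.1 hk.2.2, barrierEstimate]
  have hboth : ∀ i, i ∈ P.lowerIdx → P.lowGap xbar i = 0 → i ∈ P.upperIdx → P.upGap xbar i = 0 →
      False := by
    intro i hl hl0 hu hu0
    have h := hP.lt i
    rw [← hP.coe_toReal_l hl, ← hP.coe_toReal_u hu, EReal.coe_lt_coe_iff] at h
    unfold lowGap at hl0
    unfold upGap at hu0
    linarith
  refine ⟨WithLp.toLp 2 fun i => if i ∈ P.lowerIdx ∧ P.lowGap xbar i = 0 then ∇ P.f xbar i else 0,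
    WithLp.toLp 2 fun i => if i ∈ P.upperIdx ∧ P.upGap xbar i = 0 then -∇ P.f xbar i else 0,
    ?_, ?_, ?_⟩
  · ext i
    simp only [PiLp.add_apply, PiLp.sub_apply, PiLp.zero_apply]
    by_cases h1 : i ∈ P.lowerIdx ∧ P.lowGap xbar i = 0
    · have h2 : ¬(i ∈ P.upperIdx ∧ P.upGap xbar i = 0) := fun h2 => hboth i h1.1 h1.2 h2.1 h2.2
      simp [h1, h2]
    · by_cases h2 : i ∈ P.upperIdx ∧ P.upGap xbar i = 0
      · simp [h1, h2]
      · have h3 := ((hG i).sub (hlow i h1)).add (hup i h2)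
        have := tendsto_nhds_unique h3 (hV i)
        simpa [h1, h2] using this
  · intro i
    refine ⟨?_, ?_, ?_⟩
    · by_cases hi : i ∈ P.lowerIdx
      · rw [← hP.coe_toReal_l hi, ← EReal.coe_sub]
        exact_mod_cast hgap.1 i hi
      · have : P.l i = ⊥ := by simpa [mem_lowerIdx] using hi
        simp [this]
    · dsimp only
      split_ifs with h1
      · have h2 : ¬(i ∈ P.upperIdx ∧ P.upGap xbar i = 0) := fun h2 => hboth i h1.1 h1.2 h2.1 h2.2
        have h3 := ((hG i).add (hup i h2)).sub (hV i)
        rw [add_zero, sub_zero] at h3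
        refine ge_of_tendsto h3 ?_
        filter_upwards [hx] with k hk
        rw [hP.mem_nbhd_iff] at hk
        have := hk.1
        have := hk.2.1.trans_le (hk.2.2.1 i h1.1)
        simp only [h1.1, if_true]
        ring_nf
        positivity
      · exact le_rfl
    · by_cases h1 : i ∈ P.lowerIdx ∧ P.lowGap xbar i = 0
      · left
        rw [← hP.coe_toReal_l h1.1, ← EReal.coe_sub]
        exact_mod_cast h1.2
      · right
        simp [h1]
  · intro i
    refine ⟨?_, ?_, ?_⟩
    · by_cases hi : i ∈ P.upperIdx
      · rw [← hP.coe_toReal_u hi, ← EReal.coe_sub]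
        exact_mod_cast hgap.2 i hi
      · have : P.u i = ⊤ := by simpa [mem_upperIdx] using hi
        simp [this]
    · dsimp only
      split_ifs with h1
      · have h2 : ¬(i ∈ P.lowerIdx ∧ P.lowGap xbar i = 0) := fun h2 => hboth i h2.1 h2.2 h1.1 h1.2
        have h3 := (hV i).sub ((hG i).sub (hlow i h2))
        rw [sub_zero, zero_sub] at h3
        refine ge_of_tendsto h3 ?_
        filter_upwards [hx] with k hk
        rw [hP.mem_nbhd_iff] at hk
        have := hk.1
        have := hk.2.1.trans_le (hk.2.2.2 i h1.1)
        simp only [h1.1, if_true]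
        ring_nf
        positivity
      · exact le_rfl
    · by_cases h1 : i ∈ P.upperIdx ∧ P.upGap xbar i = 0
      · left
        rw [← hP.coe_toReal_u h1.1, ← EReal.coe_sub]
        exact_mod_cast h1.2
      · right
        simp [h1]

/-! ### Monotonicity and bounds of the barrier -/

/-- With distances to the bounds at most `χ`, the scaled logarithms are nonpositive: `φ̃` is monotone
in `μ` and bounded below by `f`. -/
theorem BoundsOK.barrier_mono (hP : P.BoundsOK) {χ θ : ℝ} (hχ : 0 < χ) (hθ : 0 < θ) {x : Vec n}
    (hx : x ∈ P.nbhd θ) (hl : ∀ i ∈ P.lowerIdx, P.lowGap x i ≤ χ)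
    (hu : ∀ i ∈ P.upperIdx, P.upGap x i ≤ χ) : Monotone (P.barrier χ x) := by
  have hg := hP.gaps_pos hθ hx
  have h1 : ∑ i ∈ P.lowerIdx, Real.log (P.lowGap x i / χ) ≤ 0 :=
    Finset.sum_nonpos fun i hi => Real.log_nonpos (div_nonneg (hg.1 i hi).le hχ.le)
      ((div_le_one hχ).2 (hl i hi))
  have h2 : ∑ i ∈ P.upperIdx, Real.log (P.upGap x i / χ) ≤ 0 :=
    Finset.sum_nonpos fun i hi => Real.log_nonpos (div_nonneg (hg.2 i hi).le hχ.le)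
      ((div_le_one hχ).2 (hu i hi))
  intro μ μ' h
  simp only [barrier]
  nlinarith

theorem BoundsOK.abs_barrierEstimate_le (hP : P.BoundsOK) {κ₂ κinf ℓ : ℝ}
    (hf : P.ObjectiveOK ℓ κ₂ κinf) {μ θ : ℝ} (hμ : 0 < μ) (hθ : 0 < θ) {x : Vec n}
    (hx : x ∈ P.nbhd θ) (i : Fin n) :
    |P.barrierEstimate (∇ P.f x) x μ i| ≤ κinf + 2 * (μ * θ⁻¹) := by
  have h1 := hf.kappaInf x (hP.nbhd_subset_feasible hθ.le hx) i
  have hB : 0 ≤ μ * θ⁻¹ := by positivity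
  rw [hP.mem_nbhd_iff] at hx
  have term : ∀ s : ℝ, θ ≤ s → |μ * s⁻¹| ≤ μ * θ⁻¹ := by
    intro s hs
    have := hθ.trans_le hs
    rw [abs_of_nonneg (by positivity)]
    gcongr
  simp only [barrierEstimate]
  refine (abs_add_le _ _).trans ?_
  have h2 := abs_sub (∇ P.f x i) (if i ∈ P.lowerIdx then μ * (P.lowGap x i)⁻¹ else 0)
  have h3 : |if i ∈ P.lowerIdx then μ * (P.lowGap x i)⁻¹ else 0| ≤ μ * θ⁻¹ := by
    split_ifs with hi
    · exact term _ (hx.1 i hi)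
    · simpa using hB
  have h4 : |if i ∈ P.upperIdx then μ * (P.upGap x i)⁻¹ else 0| ≤ μ * θ⁻¹ := by
    split_ifs with hi
    · exact term _ (hx.2 i hi)
    · simpa using hB
  linarith

end BoundProblem

/-! ### Runs of the algorithm -/

namespace RandomRun

variable {n : ℕ} {Ω : Type*} {Z : RandomRun n Ω} {P : BoundProblem n} {p : Params} {x₁ : Vec n}

theorem IsRun.X_mem (hZ : Z.IsRun P p x₁) {k : ℕ} (hk : 1 ≤ k) (ω : Ω) :
    Z.X k ω ∈ P.nbhd (p.θ (k - 1)) := by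
  obtain ⟨j, rfl⟩ := Nat.exists_eq_add_of_le' hk
  rcases Nat.eq_zero_or_pos j with rfl | hj
  · simpa [hZ.start] using hZ.start_mem
  · exact (hZ.step j hj ω).xnext_mem

theorem history_mono (m₀ : MeasurableSpace Ω) {j k : ℕ} (h : j ≤ k) :
    Z.history m₀ j ≤ Z.history m₀ k :=
  sup_le_sup_left (biSup_mono fun i hi => by
    rw [Finset.mem_Ico] at hi ⊢; omega) _

theorem measurable_G_history (m₀ : MeasurableSpace Ω) {k : ℕ} (hk : 1 ≤ k) :
    Measurable[Z.history m₀ (k + 1)] (Z.G k) := by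
  rw [measurable_iff_comap_le]
  exact le_trans (le_iSup₂_of_le k (by simp [hk]) le_rfl) le_sup_right

variable {m₀ : MeasurableSpace Ω} [mΩ : MeasurableSpace Ω] {ℙ : Measure Ω}

theorem EstimatorsOK.history_le (hG : Z.EstimatorsOK m₀ ℙ P p) (k : ℕ) : Z.history m₀ k ≤ mΩ :=
  sup_le hG.init_le (iSup₂_le fun j hj =>
    (hG.measurable_G j (Finset.mem_Ico.1 hj).1).comap_le)

theorem IsRun.measurable_X (hZ : Z.IsRun P p x₁) (hP : P.BoundsOK) (hp : p.Admissible P)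
    (hG : Z.EstimatorsOK m₀ ℙ P p) {k : ℕ} (hk : 1 ≤ k) :
    Measurable[Z.history m₀ k] (Z.X k) := by
  induction k, hk using Nat.le_induction with
  | base =>
    rw [funext hZ.start]
    exact measurable_const
  | succ k hk ih =>
    have hle := history_mono (Z := Z) m₀ k.le_succ
    exact @IsStep.measurable_xnext n P p Ω (Z.history m₀ (k + 1)) hP hp k hk _ _ _ _ _ _ _ _ _
      (hZ.step k hk) (hZ.X_mem hk) (ih.mono hle le_rfl) (measurable_G_history m₀ hk)
      fun i j => (hG.measurable_H k hk i j).mono hle le_rfl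

/-- Along almost every run, the squared barrier gradients are summable with the guaranteed step
lengths as weights.  The one-step decreases are summed; in expectation the terms linear in the noise
vanish, and the remaining perturbations are summable. -/
theorem ae_summable [IsProbabilityMeasure ℙ] (hP : P.BoundsOK)
    (hf : P.ObjectiveOK p.lip p.kappa2 p.kappaInf) (hp : p.Admissible P) (hZ : Z.IsRun P p x₁)
    {χ : ℝ} (hχ : Z.BoundedIterates ℙ P χ) (hG : Z.EstimatorsOK m₀ ℙ P p) :
    ∀ᵐ ω ∂ℙ, Summable fun k : ℕ => p.γmin P (k + 1) * p.αmin (k + 1) *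
      normSqInv (Z.H (k + 1) ω) (P.barrierGrad χ (Z.X (k + 1) ω) (p.μ (k + 1))) := by
  obtain ⟨hχ1, S, -, -, hbd⟩ := hχ
  have hχ0 : 0 < χ := by linarith
  have hℓ := hf.lip_pos
  have hκ := hf.kappaInf_pos
  set v : ℕ → Ω → Vec n := fun k ω => P.barrierEstimate (∇ P.f (Z.X k ω)) (Z.X k ω) (p.μ k) with hv
  set e : ℕ → Ω → Vec n := fun k ω => Z.G k ω - ∇ P.f (Z.X k ω) with he
  set u : ℕ → Ω → Vec n := fun k ω => WithLp.toLp 2 fun i => v k ω i / Z.H k ω i i with hu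
  set w : ℕ → ℝ := fun k => p.γmin P k * p.αmin k with hw
  set B : ℝ := p.kappaInf + 2 * (p.μ 1 / p.θ 0) with hB
  have hw0 : ∀ k, 1 ≤ k → 0 < w k := fun k hk =>
    mul_pos (hp.γmin_pos hℓ hκ hk) (hp.αmin_pos hℓ hk)
  have hB0 : 0 ≤ B := by have := hp.μ_one_pos; have := hp.θ_zero_pos; positivity
  have hfeas : ∀ k, 1 ≤ k → ∀ ω, Z.X k ω ∈ P.feasible := fun k hk ω =>
    hP.nbhd_subset_feasible (hp.θ_pos _).le (hZ.X_mem hk ω)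
  have hvB : ∀ k, 1 ≤ k → ∀ ω i, |v k ω i| ≤ B := by
    intro k hk ω i
    have := hP.abs_barrierEstimate_le hf (hp.μ_pos hk) (hp.θ_pos _) (hZ.X_mem hk ω) i
    rwa [hp.μ_mul_inv_θ_pred hk] at this
  have huB : ∀ k, 1 ≤ k → ∀ ω i, |u k ω i| ≤ B / p.lamMin k := by
    intro k hk ω i
    have h1 := (hZ.step k hk ω).H_pos hp hk i
    simp only [hu, abs_div, abs_of_pos h1]
    exact (div_le_div_of_nonneg_right (hvB k hk ω i) h1.le).trans
      (div_le_div_of_nonneg_left hB0 (hp.lamMin_pos hk) ((hZ.step k hk ω).lamMin_le i))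
  have hvm : ∀ k, 1 ≤ k → Measurable[Z.history m₀ k] (v k) := fun k hk =>
    have hX := hZ.measurable_X hP hp hG hk
    @measurable_barrierEstimate n P Ω (Z.history m₀ k) _ _ ((measurable_gradient P.f).comp hX) hX _
  have hum : ∀ k, 1 ≤ k → Measurable[Z.history m₀ k] (u k) := fun k hk =>
    @measurable_vec n Ω (Z.history m₀ k) _ fun i =>
      (@measurable_coord n Ω (Z.history m₀ k) _ (hvm k hk) i).div (hG.measurable_H k hk i i)
  have hinner : ∀ k ω, inner ℝ (u k ω) (e k ω) = ∑ i, v k ω i / Z.H k ω i i * e k ω i := by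
    intro k ω
    rw [PiLp.inner_apply]
    refine Finset.sum_congr rfl fun i _ => ?_
    simp only [hu, RCLike.inner_apply, conj_trivial]
    ring
  -- the terms linear in the noise are integrable and centered
  have hlin : ∀ k, 1 ≤ k → Integrable (fun ω => inner ℝ (u k ω) (e k ω)) ℙ ∧
      ∫ ω, inner ℝ (u k ω) (e k ω) ∂ℙ = 0 := by
    intro k hk
    refine integral_inner_sub_condExp (hG.history_le k) (C := ∑ _i : Fin n, B / p.lamMin k)
      (hum k hk) (fun ω => ?_) ?_ ?_ (g := Z.G k)
    · have h1 : ‖u k ω‖ ≤ ∑ i, |u k ω i| := by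
        rw [EuclideanSpace.norm_eq]
        simpa using Real.sqrt_le_iff.2 ⟨Finset.sum_nonneg fun i _ => abs_nonneg (u k ω i),
          Finset.sum_sq_le_sq_sum_of_nonneg fun i _ => abs_nonneg (u k ω i)⟩
      exact h1.trans (Finset.sum_le_sum fun i _ => huB k hk ω i)
    · refine Integrable.of_bound (hG.measurable_G k hk).aestronglyMeasurable
        (p.sigma2 + p.kappa2) ?_
      filter_upwards [hG.error2 k hk] with ω hω
      have := norm_add_le (Z.G k ω - ∇ P.f (Z.X k ω)) (∇ P.f (Z.X k ω))
      rw [sub_add_cancel] at this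
      linarith [hf.kappa2 _ (hfeas k hk ω)]
    · filter_upwards [hG.unbiased k hk] with ω hω
      rw [hω]
  obtain ⟨ε, hεs, hε0, hε⟩ := hp.exists_summable_error hℓ hκ
    (a := n * (B * p.sigma2)) (b := p.sigma2 ^ 2 / 2)
    (mul_nonneg n.cast_nonneg (mul_nonneg hB0 hp.sigma2_nonneg)) (by positivity)
  -- one-step decrease along almost every run
  have hstep : ∀ᵐ ω ∂ℙ, ∀ k, 1 ≤ k →
      w k / 2 * (∑ i, v k ω i ^ 2 / Z.H k ω i i) + P.barrier χ (Z.X (k + 1) ω) (p.μ (k + 1)) ≤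
        P.barrier χ (Z.X k ω) (p.μ k) + ε k
          - w k * (1 - (k : ℝ) ^ p.tα) * inner ℝ (u k ω) (e k ω) := by
    have h2 := ae_all_iff.2 fun k => ae_all_iff.2 fun hk => hG.error2 k hk
    have hinf := ae_all_iff.2 fun k => ae_all_iff.2 fun hk => hG.errorInf k hk
    filter_upwards [h2, hinf, hbd] with ω h2 hinf hbd k hk
    have hs := hZ.step k hk ω
    have hlam := hp.lamMin_pos hk
    have hg : ∀ i, |Z.G k ω i| ≤ p.kappaInf + p.sigmaInf := by
      intro i
      have h1 := abs_add_le (Z.G k ω i - ∇ P.f (Z.X k ω) i) (∇ P.f (Z.X k ω) i)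
      rw [sub_add_cancel] at h1
      linarith [hinf k hk i, hf.kappaInf _ (hfeas k hk ω) i]
    have hd := hs.decrease hp hP hf hk (hZ.X_mem hk ω) hχ0 hg (v := v k ω) (e := e k ω) rfl rfl
    have hmono : P.barrier χ (Z.X (k + 1) ω) (p.μ (k + 1)) ≤
        P.barrier χ (Z.X (k + 1) ω) (p.μ k) :=
      hP.barrier_mono hχ0 (hp.θ_pos _) (hZ.X_mem (k := k + 1) (by omega) ω)
        (hbd (k + 1) (by omega)).2.1 (hbd (k + 1) (by omega)).2.2 (hp.μ_succ_le hk)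
    have hVE : |∑ i, v k ω i / Z.H k ω i i * e k ω i| ≤ n * (B * p.sigma2) / p.lamMin k := by
      refine (Finset.abs_sum_le_sum_abs _ _).trans ?_
      have : ∀ i ∈ Finset.univ, |v k ω i / Z.H k ω i i * e k ω i| ≤
          B / p.lamMin k * p.sigma2 := by
        intro i _
        rw [abs_mul]
        refine mul_le_mul (huB k hk ω i) ?_ (abs_nonneg _) (div_nonneg hB0 hlam.le)
        exact (PiLp.norm_apply_le (e k ω) i).trans (h2 k hk)
      refine (Finset.sum_le_sum this).trans_eq ?_
      rw [Finset.sum_const, Finset.card_univ, Fintype.card_fin, nsmul_eq_mul]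
      ring
    have hEE : ∑ i, e k ω i ^ 2 / Z.H k ω i i ≤ p.sigma2 ^ 2 / p.lamMin k := by
      calc ∑ i, e k ω i ^ 2 / Z.H k ω i i ≤ ∑ i, e k ω i ^ 2 / p.lamMin k :=
            Finset.sum_le_sum fun i _ =>
              div_le_div_of_nonneg_left (sq_nonneg _) hlam (hs.lamMin_le i)
        _ = ‖e k ω‖ ^ 2 / p.lamMin k := by
            rw [EuclideanSpace.real_norm_sq_eq, Finset.sum_div]
        _ ≤ _ := by
            gcongr
            exact h2 k hk
    have hεk := hε k hk
    have hWw : p.γmin P k * p.αmin k ≤ p.γmax P k * p.αmax k :=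
      mul_le_mul (hp.γmin_le_γmax hk) (hp.αmin_le_αmax hk) (hp.αmin_pos hℓ hk).le
        ((hp.γmin_pos hℓ hκ hk).le.trans (hp.γmin_le_γmax hk))
    have hz0 := natCast_rpow_pos hk p.tα
    have hW0 : 0 ≤ p.γmax P k * p.αmax k := (hw0 k hk).le.trans hWw
    have i1 := mul_le_mul_of_nonneg_left hVE (sub_nonneg.2 hWw)
    have i2 := mul_le_mul_of_nonneg_left hEE
      (by positivity : 0 ≤ (k : ℝ) ^ p.tα * (p.γmax P k * p.αmax k) / 2)
    have i3 : (k : ℝ) ^ p.tα * (p.γmax P k * p.αmax k) / 2 * (p.sigma2 ^ 2 / p.lamMin k) =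
      (k : ℝ) ^ p.tα * (p.γmax P k * p.αmax k) * (p.sigma2 ^ 2 / 2 / p.lamMin k) := by ring
    rw [hinner]
    simp only [hw]
    linarith
  obtain ⟨fmin, hfmin⟩ := hf.bddBelow
  have hlower : ∀ᵐ ω ∂ℙ, ∀ k, 1 ≤ k → fmin ≤ P.barrier χ (Z.X k ω) (p.μ k) := by
    filter_upwards [hbd] with ω hbd k hk
    have h1 := hP.barrier_mono hχ0 (hp.θ_pos _) (hZ.X_mem hk ω) (hbd k hk).2.1 (hbd k hk).2.2
      (hp.μ_pos hk).le
    have h2 : P.barrier χ (Z.X k ω) 0 = P.f (Z.X k ω) := by simp [BoundProblem.barrier]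
    rw [h2] at h1
    exact (hfmin (Set.mem_image_of_mem _ (hfeas k hk ω))).trans h1
  set C := P.barrier χ x₁ (p.μ 1) - fmin + ∑' k, ε (k + 1) with hC
  set f : ℕ → Ω → ℝ := fun k ω =>
    w (k + 1) / 2 * ∑ i, v (k + 1) ω i ^ 2 / Z.H (k + 1) ω i i with hfdef
  have hsum : ∀ᵐ ω ∂ℙ, ∀ K : ℕ, ∑ k ∈ Finset.range K, f k ω ≤ C - ∑ k ∈ Finset.range K,
      w (k + 1) * (1 - ((k + 1 : ℕ) : ℝ) ^ p.tα) * inner ℝ (u (k + 1) ω) (e (k + 1) ω) := by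
    filter_upwards [hstep, hlower] with ω hstep hlower K
    have htel : ∀ K : ℕ, ∑ k ∈ Finset.range K, f k ω
        + P.barrier χ (Z.X (K + 1) ω) (p.μ (K + 1)) ≤
        P.barrier χ x₁ (p.μ 1) + ∑ k ∈ Finset.range K, ε (k + 1) - ∑ k ∈ Finset.range K,
          w (k + 1) * (1 - ((k + 1 : ℕ) : ℝ) ^ p.tα) * inner ℝ (u (k + 1) ω) (e (k + 1) ω) := by
      intro K
      induction K with
      | zero => simp [hZ.start]
      | succ K ih =>
        have := hstep (K + 1) (by omega)
        rw [Finset.sum_range_succ, Finset.sum_range_succ, Finset.sum_range_succ]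
        simp only [hfdef] at ih ⊢
        linarith
    have h1 := htel K
    have h2 := hlower (K + 1) (by omega)
    have h3 := ((summable_nat_add_iff 1).2 hεs).sum_le_tsum (Finset.range K)
      fun k _ => hε0 (k + 1)
    linarith
  have hf0 : ∀ k ω, 0 ≤ f k ω := fun k ω =>
    mul_nonneg (half_pos (hw0 _ (by omega))).le (Finset.sum_nonneg fun i _ =>
      div_nonneg (sq_nonneg _) ((hZ.step (k + 1) (by omega) ω).H_pos hp (by omega) i).le)
  have hfint : ∀ k, Integrable (f k) ℙ := by
    intro k
    have hk : 1 ≤ k + 1 := by omega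
    refine Integrable.const_mul (integrable_finsetSum _ fun i _ => ?_) _
    refine Integrable.of_bound (C := B ^ 2 / p.lamMin (k + 1)) ?_ (ae_of_all _ fun ω => ?_)
    · have h1 := (hvm (k + 1) hk).mono (hG.history_le _) le_rfl
      have h2 := (hG.measurable_H (k + 1) hk i i).mono (hG.history_le _) le_rfl
      exact (((measurable_coord h1 i).pow_const 2).div h2).aestronglyMeasurable
    · have h1 := (hZ.step (k + 1) hk ω).H_pos hp hk i
      rw [Real.norm_of_nonneg (div_nonneg (sq_nonneg _) h1.le)]
      refine div_le_div₀ (sq_nonneg _) (sq_le_sq' ?_ ?_) (hp.lamMin_pos hk)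
        ((hZ.step (k + 1) hk ω).lamMin_le i)
      · exact (abs_le.1 (hvB _ hk ω i)).1
      · exact (abs_le.1 (hvB _ hk ω i)).2
  have hbound : ∀ K : ℕ, ∑ k ∈ Finset.range K, ∫ ω, f k ω ∂ℙ ≤ C := by
    intro K
    rw [← integral_finsetSum _ fun k _ => hfint k]
    have hl := fun k : ℕ => (hlin (k + 1) (by omega)).1.const_mul
      (w (k + 1) * (1 - ((k + 1 : ℕ) : ℝ) ^ p.tα))
    refine (integral_mono_ae (integrable_finsetSum _ fun k _ => hfint k)
      ((integrable_const C).sub (integrable_finsetSum (Finset.range K) fun k _ => hl k)) ?_).trans ?_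
    · filter_upwards [hsum] with ω hω
      simpa using hω K
    · simp only [Pi.sub_apply]
      rw [integral_sub (integrable_const C) (integrable_finsetSum _ fun k _ => hl k),
        integral_finsetSum _ fun k _ => hl k]
      simp [integral_const_mul, (hlin (_ + 1) (Nat.le_add_left 1 _)).2]
  filter_upwards [ae_summable_of_sum_integral_le hf0 hfint hbound] with ω hω
  refine (hω.mul_left 2).congr fun k => ?_
  have hk : 1 ≤ k + 1 := by omega
  rw [(hZ.step (k + 1) hk ω).normSqInv_eq hp hk, hP.barrierGrad_eq hf hχ0 (hp.θ_pos _)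
    (hZ.X_mem hk ω)]
  simp only [hfdef, hv, hw]
  ring

end RandomRun

end BoundIPM

theorem theorem2 {n : ℕ} (P : BoundIPM.BoundProblem n) (p : BoundIPM.Params)
    (hP : P.BoundsOK) (hf : P.ObjectiveOK p.lip p.kappa2 p.kappaInf)
    (hp : p.Admissible P)
    {Ω : Type*} (m₀ : MeasurableSpace Ω) [mΩ : MeasurableSpace Ω] (ℙ : Measure Ω) [IsProbabilityMeasure ℙ]
    (Z : BoundIPM.RandomRun n Ω) (x₁ : BoundIPM.Vec n) (hZ : Z.IsRun P p x₁)
    (χ : ℝ) (hχ : Z.BoundedIterates ℙ P χ)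
    (hG : Z.EstimatorsOK m₀ ℙ P p) :
    (∀ᵐ ω ∂ℙ, liminf (fun k : ℕ =>
        ((BoundIPM.normSqInv (Z.H k ω) (P.barrierGrad χ (Z.X k ω) (p.μ k)) : ℝ) : EReal))
        atTop = 0) ∧
    ((∃ r : ℝ, 0 < r ∧ ∀ k : ℕ, 1 ≤ k → p.lamMax k ≤ r) →
      ∀ᵐ ω ∂ℙ, liminf (fun k : ℕ =>
        ((‖P.barrierGrad χ (Z.X k ω) (p.μ k)‖ ^ 2 : ℝ) : EReal)) atTop = 0) ∧
    (∀ ω, ∀ K : Set ℕ, K.Infinite → ∀ xbar ∈ P.feasible,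
      Tendsto (fun k => P.barrierGrad χ (Z.X k ω) (p.μ k)) (atTop ⊓ 𝓟 K) (𝓝 0) →
      Tendsto (fun k => Z.X k ω) (atTop ⊓ 𝓟 K) (𝓝 xbar) →
      P.IsKKT xbar) := by
  have hχ0 : 0 < χ := by linarith [hχ.1]
  obtain ⟨c, hc, hw⟩ := hp.le_γmin_mul_αmin hf.lip_pos hf.kappaInf_pos
  have hsum := BoundIPM.RandomRun.ae_summable hP hf hp hZ hχ hG
  refine ⟨?_, ?_, ?_⟩
  · filter_upwards [hsum] with ω hω
    refine BoundIPM.liminf_eq_zero_of_summable (fun k hk => ?_) hc hw hω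
    rw [(hZ.step k hk ω).normSqInv_eq hp hk]
    exact Finset.sum_nonneg fun i _ =>
      div_nonneg (sq_nonneg _) ((hZ.step k hk ω).H_pos hp hk i).le
  · rintro ⟨r, hr, hlam⟩
    filter_upwards [hsum] with ω hω
    refine BoundIPM.liminf_eq_zero_of_summable (fun k _ => sq_nonneg _) hc hw ?_
    refine (hω.mul_left r).of_nonneg_of_le (fun k => ?_) fun k => ?_
    · exact mul_nonneg (le_trans (by positivity) (hw (k + 1) (by omega))) (sq_nonneg _)
    · have hk : 1 ≤ k + 1 := by omega
      have hs := hZ.step (k + 1) hk ω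
      rw [mul_left_comm]
      refine mul_le_mul_of_nonneg_left ?_ (le_trans (by positivity) (hw (k + 1) hk))
      rw [hs.normSqInv_eq hp hk, EuclideanSpace.real_norm_sq_eq, Finset.mul_sum]
      refine Finset.sum_le_sum fun i _ => ?_
      have hH := hs.H_pos hp hk i
      rw [← mul_div_assoc, le_div_iff₀ hH, mul_comm]
      exact mul_le_mul_of_nonneg_right ((hs.le_lamMax i).trans (hlam _ hk)) (sq_nonneg _)
  · intro ω K hK xbar hxbar hgrad hlim
    have : (atTop ⊓ 𝓟 K).NeBot := by
      rw [← Nat.cofinite_eq_atTop]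
      exact hK.cofinite_inf_principal_neBot
    refine hP.isKKT_of_tendsto hf hχ0 (θ := fun k => p.θ (k - 1)) ?_
      (hp.tendsto_μ.mono_left inf_le_left) hxbar hgrad hlim
    refine (eventually_ge_atTop 1).filter_mono inf_le_left |>.mono fun k hk => ?_
    exact ⟨hp.μ_pos hk, hp.θ_pos _, hZ.X_mem hk ω⟩
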